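/- Let $M=\begin{pmatrix}a&b\\c&d\end{pmatrix}\in GL(2,\mathbb Z)$ have no eigenvalue of modulus one, let $T$ be the hyperbolic automorphism $x\mapsto Mx$ of $\mathbb T^2=\mathbb R^2/\mathbb Z^2$, and put $r=\operatorname{Tr}M$, $\sigma=\det M=\pm1$, $C_{r,\sigma}=\begin{pmatrix}r&1\\-\sigma&0\end{pmatrix}$ and $f_T(x,y)=bx^2-(a-d)xy-cy^2$. Definition (for $r>0$). Let $\lambda=\frac12\bigl(r+\sqrt{r^2-4\sigma}\bigr)>1$. Let $\widetilde{\mathfrak X}$ be the additive semigroup of two-sided sequences $(\varepsilon_n)_{n\in\mathbb Z}$ of nonnegative integers for which $\sum_{n\ge1}\varepsilon_n\lambda^{-n}$ and $\sum_{n\ge1}\varepsilon_{-n}\lambda^{-n}$ converge, with the coarsest topology in which all coordinates and both sums are continuous, and with the shift $(\tau\varepsilon)_n=\varepsilon_{n+1}$. An arithmetic coding of $T$ is a pair $(\varphi,\mathfrak X)$, where $\varphi:\widetilde{\mathfrak X}\to\mathbb T^2$ is a continuous semigroup homomorphism (with $\varphi(0)=0$) such that $\varphi\tau=T\varphi$,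 and $\mathfrak X\subset\widetilde{\mathfrak X}$ is a closed set with $\tau^{-1}\mathfrak X=\mathfrak X$ such that: $\varphi(\mathfrak X)=\mathbb T^2$; $\varphi$ is one-to-one on the sequences in $\mathfrak X$ with finitely many nonzero terms; and $\mathfrak X$ is total, i.e. if $\varepsilon\in\mathfrak X$, $N\in\mathbb Z$ and $\varepsilon'\in\widetilde{\mathfrak X}$ are such that $(\varepsilon'_k,\varepsilon'_{k+1},\dots)$ is lexicographically (strictly) less than $(\varepsilon_N,\varepsilon_{N+1},\dots)$ for every $k\in\mathbb Z$, then $\varepsilon'\in\mathfrak X$. It is bijective (a.e.) if Lebesgue-almost every point of $\mathbb T^2$ has exactly one preimage under $\varphi$ in $\mathfrak X$. Theorem. I. If $r>0$, then $T$ admits a bijective arithmetic coding if and only if there is $B\in GL(2,\mathbb Z)$ with $BMB^{-1}=C_{r,\sigma}$. If $r<0$, the same holds with the automorphism $-T$ (given by $-M$, of positive trace) in place of $T$ on the left-hand side: $-T$ admits a bijective arithmetic coding if and only if $M$ is conjugate in $GL(2,\mathbb Z)$ to $C_{r,\sigma}$. II. (For either sign of $r$.) $M$ is conjugate in $GL(2,\mathbb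 Z)$ to $C_{r,\sigma}$ if and only if $f_T(x,y)=1$ or $f_T(x,y)=-1$ has a solution $(x,y)\in\mathbb Z^2$. Moreover $B=\begin{pmatrix}x&y\\z&t\end{pmatrix}\mapsto(x,y)$ is a bijection from the set of all $B\in GL(2,\mathbb Z)$ with $BMB^{-1}=C_{r,\sigma}$ onto the set of all $(x,y)\in\mathbb Z^2$ with $f_T(x,y)=\pm1$, and for every such $B$ one has $(z,t)=-\det M\cdot(x,y)M^{-1}$. -/

import Mathlib

open MeasureTheory
open scoped MatrixGroups

noncomputable section

namespace ToralCoding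

/-- The 2-torus `(ℝ/ℤ)²`; its `volume` is the normalized Lebesgue (Haar) measure. -/
abbrev Torus : Type := UnitAddTorus (Fin 2)

/-- The endomorphism `x ↦ M x` of the torus given by an integer matrix (column convention). -/
def toralMap (M : Matrix (Fin 2) (Fin 2) ℤ) : Torus →+ Torus where
  toFun x := fun i => ∑ j, M i j • x j
  map_zero' := by
    funext i
    simp
  map_add' x y := by
    funext i
    simp [smul_add, Finset.sum_add_distrib]

/-- `M` has no (complex) eigenvalue of modulus one. -/
def IsHyperbolic (M : Matrix (Fin 2) (Fin 2) ℤ) : Prop :=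
  ∀ z ∈ spectrum ℂ (M.map (Int.cast : ℤ → ℂ)), ‖z‖ ≠ 1

/-- `λ = (r + √D) / 2` with `r = Tr M`, `D = r² - 4 det M`: for positive trace this is the
eigenvalue of `M` of largest modulus. -/
def leadingEigenvalue (M : Matrix (Fin 2) (Fin 2) ℤ) : ℝ :=
  ((M.trace : ℝ) + Real.sqrt ((M.trace : ℝ) ^ 2 - 4 * (M.det : ℝ))) / 2

/-- The semigroup (under coordinate-wise addition) of two-sided sequences of nonnegative
integers for which `∑_{n ≥ 1} ε_n β⁻ⁿ` and `∑_{n ≥ 1} ε_{-n} β⁻ⁿ` converge. -/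
def digitSemigroup (β : ℝ) : AddSubmonoid (ℤ → ℕ) where
  carrier := {ε | Summable (fun n : ℕ => (ε ((n : ℤ) + 1) : ℝ) * (β ^ (n + 1))⁻¹) ∧
    Summable (fun n : ℕ => (ε (-((n : ℤ) + 1)) : ℝ) * (β ^ (n + 1))⁻¹)}
  zero_mem' := by
    constructor <;> simp [summable_zero]
  add_mem' := by
    rintro a b ⟨ha, ha'⟩ ⟨hb, hb'⟩
    exact ⟨by simpa [add_mul] using ha.add hb, by simpa [add_mul] using ha'.add hb'⟩

/-- The primary symbolic space. It is a type of its own because its topology is not the one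
induced by the product. -/
def SymbolicSpace (β : ℝ) : Type := digitSemigroup β

namespace SymbolicSpace

variable {β : ℝ}

instance : AddCommMonoid (SymbolicSpace β) :=
  inferInstanceAs (AddCommMonoid (digitSemigroup β))

/-- The `n`-th digit. -/
def digit (ε : SymbolicSpace β) (n : ℤ) : ℕ := ε.1 n

/-- `∑_{n ≥ 1} ε_n β⁻ⁿ`. -/
def rightSum (ε : SymbolicSpace β) : ℝ :=
  ∑' n : ℕ, (ε.digit ((n : ℤ) + 1) : ℝ) * (β ^ (n + 1))⁻¹

/-- `∑_{n ≥ 1} ε_{-n} β⁻ⁿ`. -/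
def leftSum (ε : SymbolicSpace β) : ℝ :=
  ∑' n : ℕ, (ε.digit (-((n : ℤ) + 1)) : ℝ) * (β ^ (n + 1))⁻¹

/-- The natural weak topology: the coarsest one for which all the digits and the two series
that define the space depend continuously on the sequence. On a set of sequences with uniformly
bounded digits (when `β > 1`) this is the product topology. -/
instance : TopologicalSpace (SymbolicSpace β) :=
  TopologicalSpace.induced
    (fun ε : SymbolicSpace β => (ε.digit, ε.rightSum, ε.leftSum)) inferInstance

/-- The two-sided shift `(τ ε)_n = ε_{n+1}`. -/
def shift (ε : SymbolicSpace β) : SymbolicSpace β :=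
  ⟨fun n => ε.1 (n + 1), by
    obtain ⟨e, h1, h2⟩ := ε
    by_cases hβ : β = 0
    · subst hβ
      constructor <;> simp [summable_zero]
    constructor
    · have h := ((summable_nat_add_iff 1).2 h1).mul_left β
      refine h.congr fun n => ?_
      have e1 : (((n + 1 : ℕ) : ℤ) + 1) = (n : ℤ) + 1 + 1 := by push_cast; ring
      simp only [e1]
      field_simp
      ring
    · refine (summable_nat_add_iff 1).1 ?_
      refine (h2.mul_left β⁻¹).congr fun n => ?_
      have e1 : (-(((n + 1 : ℕ) : ℤ) + 1) + 1) = -((n : ℤ) + 1) := by push_cast; ring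
      simp only [e1]
      field_simp
      ring⟩

/-- A sequence is finite if it has only finitely many nonzero digits. -/
def IsFinite (ε : SymbolicSpace β) : Prop := {n : ℤ | ε.digit n ≠ 0}.Finite

/-- `(ε'_k, ε'_{k+1}, …)` is lexicographically less than `(ε_N, ε_{N+1}, …)`. -/
def TailLexLT (ε' : SymbolicSpace β) (k : ℤ) (ε : SymbolicSpace β) (N : ℤ) : Prop :=
  ∃ j : ℕ, (∀ i : ℕ, i < j → ε'.digit (k + i) = ε.digit (N + i)) ∧
    ε'.digit (k + j) < ε.digit (N + j)

/-- A set of sequences is total if with every `ε` it contains every `ε'` all of whose tails are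
lexicographically less than some fixed tail of `ε`. -/
def IsTotal (X : Set (SymbolicSpace β)) : Prop :=
  ∀ ε ∈ X, ∀ ε' : SymbolicSpace β,
    (∃ N : ℤ, ∀ k : ℤ, TailLexLT ε' k ε N) → ε' ∈ X

end SymbolicSpace

/-- `(φ, X)` is an arithmetic coding of the toral automorphism with matrix `M` (of positive
trace): `φ` is a continuous semigroup homomorphism to the torus that turns the shift into the
automorphism, and `X` is a closed, shift-invariant, total set of sequences, mapped onto the torus,
on whose finite sequences `φ` is one-to-one. -/
structure IsArithmeticCoding (M : Matrix (Fin 2) (Fin 2) ℤ)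
    (φ : SymbolicSpace (leadingEigenvalue M) →+ Torus)
    (X : Set (SymbolicSpace (leadingEigenvalue M))) : Prop where
  continuous : Continuous φ
  map_shift : ∀ ε, φ ε.shift = toralMap M (φ ε)
  isClosed : IsClosed X
  shift_invariant : ∀ ε : SymbolicSpace (leadingEigenvalue M), ε.shift ∈ X ↔ ε ∈ X
  total : SymbolicSpace.IsTotal X
  surjective : ∀ x : Torus, ∃ ε ∈ X, φ ε = x
  injective_on_finite : Set.InjOn φ {ε | ε ∈ X ∧ ε.IsFinite}

/-- There is an arithmetic coding `(φ, X)` with `φ : X → 𝕋²` bijective almost everywhere: almost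
every point of the torus (for Lebesgue measure) has exactly one preimage in `X`. -/
def AdmitsBijectiveArithmeticCoding (M : Matrix (Fin 2) (Fin 2) ℤ) : Prop :=
  ∃ (φ : SymbolicSpace (leadingEigenvalue M) →+ Torus)
    (X : Set (SymbolicSpace (leadingEigenvalue M))),
    IsArithmeticCoding M φ X ∧
      ∀ᵐ x ∂(volume : Measure Torus), ∃! ε, ε ∈ X ∧ φ ε = x

/-- `B` conjugates `M₁` into `M₂`: `B M₁ B⁻¹ = M₂`. -/
def Conjugates (B : GL (Fin 2) ℤ) (M₁ M₂ : Matrix (Fin 2) (Fin 2) ℤ) : Prop :=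
  (B : Matrix (Fin 2) (Fin 2) ℤ) * M₁ * ((B⁻¹ : GL (Fin 2) ℤ) : Matrix (Fin 2) (Fin 2) ℤ) = M₂

/-- Algebraic conjugacy, i.e. conjugacy by an element of `GL(2, ℤ)`. -/
def AlgebraicallyConjugate (M₁ M₂ : Matrix (Fin 2) (Fin 2) ℤ) : Prop :=
  ∃ B : GL (Fin 2) ℤ, Conjugates B M₁ M₂

/-- The companion matrix `C_{r,σ}`. -/
def companionMatrix (r σ : ℤ) : Matrix (Fin 2) (Fin 2) ℤ := !![r, 1; -σ, 0]

/-- The quadratic form `b x² - (a - d) x y - c y²` associated with `M = (a b; c d)`. -/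
def associatedForm (M : Matrix (Fin 2) (Fin 2) ℤ) (x y : ℤ) : ℤ :=
  M 0 1 * x ^ 2 - (M 0 0 - M 1 1) * x * y - M 1 0 * y ^ 2

end ToralCoding

end

open ToralCoding

/-!
The equation `B M = C B` with the companion matrix `C` expresses the second row of `B` through the
first one, and then `det B` is the value of `associatedForm M` at the first row.

Let `β > 1` and `μ` be the eigenvalues of `M`. The homomorphism `φ` of an arithmetic coding is
determined by the image of the sequence with the single digit one, which is a homoclinic point, so
that `φ` is the composition of the map `ε ↦ (u, v) ∈ ℝ²` reading off the values of the future in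
base `β` and of the past in base `μ⁻¹`, of a linear map attached to some `l ∈ ℤ²`, and of the
projection onto the torus. Sequences bounded away from the quasi-greedy expansion of one have
nowhere dense sets of futures, so by Baire's theorem `X` is not made of such sequences only, and
then, being total and closed, contains all the admissible sequences. Their pairs `(u, v)` represent
every point of the plane modulo the image of `ℤ[β]` under its two embeddings. If `l` and `M l`
generated a proper subgroup of `ℤ²`, every point of the torus would therefore have several
preimages. Hence they generate `ℤ²`, which means that `associatedForm M` takes the value `1` or
`-1` at `(l₁, -l₀)`.

Conversely, if they generate `ℤ²`, then the pairs `(u, v)` of the admissible sequences lie in two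
rectangles of total area `β - μ`, the covolume of this lattice. Since they represent every point,
the rectangles form a fundamental domain up to null sets, and almost every point has a single
admissible expansion.
-/

noncomputable section

namespace ToralCoding

open Filter Topology
open scoped Pointwise
open SymbolicSpace

/-! ### Conjugacy to the companion matrix -/

lemma conjugates_iff_mul_eq_mul {B : GL (Fin 2) ℤ} {M₁ M₂ : Matrix (Fin 2) (Fin 2) ℤ} :
    Conjugates B M₁ M₂ ↔ (B : Matrix (Fin 2) (Fin 2) ℤ) * M₁ = M₂ * B :=
  Units.mul_inv_eq_iff_eq_mul B

lemma mul_eq_companionMatrix_mul_iff {B M : Matrix (Fin 2) (Fin 2) ℤ} :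
    B * M = companionMatrix M.trace M.det * B ↔
      B 1 0 = -B 0 0 * M 1 1 + B 0 1 * M 1 0 ∧ B 1 1 = B 0 0 * M 0 1 - B 0 1 * M 0 0 := by
  simp only [← Matrix.ext_iff, Fin.forall_fin_two, Matrix.mul_apply, Fin.sum_univ_two,
    companionMatrix, Matrix.trace_fin_two, Matrix.det_fin_two, Matrix.of_apply, Matrix.cons_val',
    Matrix.cons_val_zero, Matrix.cons_val_one, Matrix.cons_val_fin_one]
  constructor
  · rintro ⟨⟨h₀, h₁⟩, -⟩
    constructor <;> linarith
  · rintro ⟨h₀, h₁⟩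
    rw [h₀, h₁]
    refine ⟨⟨by ring, by ring⟩, by ring, by ring⟩

lemma det_eq_associatedForm_of_mul_eq {B M : Matrix (Fin 2) (Fin 2) ℤ}
    (h : B * M = companionMatrix M.trace M.det * B) :
    B.det = associatedForm M (B 0 0) (B 0 1) := by
  obtain ⟨h₀, h₁⟩ := mul_eq_companionMatrix_mul_iff.1 h
  rw [Matrix.det_fin_two, h₀, h₁, associatedForm]
  ring

theorem bijOn_conjugates (M : Matrix (Fin 2) (Fin 2) ℤ) :
    Set.BijOn
      (fun B : GL (Fin 2) ℤ =>
        ((B : Matrix (Fin 2) (Fin 2) ℤ) 0 0, (B : Matrix (Fin 2) (Fin 2) ℤ) 0 1))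
      {B | Conjugates B M (companionMatrix M.trace M.det)}
      {p | associatedForm M p.1 p.2 = 1 ∨ associatedForm M p.1 p.2 = -1} := by
  simp only [conjugates_iff_mul_eq_mul]
  refine ⟨fun B hB => ?_, fun B hB B' hB' h => ?_, ?_⟩
  · have hdet := (Matrix.isUnit_iff_isUnit_det _).1 B.isUnit
    rw [det_eq_associatedForm_of_mul_eq hB] at hdet
    exact Int.isUnit_iff.1 hdet
  · obtain ⟨h₀, h₁⟩ := mul_eq_companionMatrix_mul_iff.1 hB
    obtain ⟨h₀', h₁'⟩ := mul_eq_companionMatrix_mul_iff.1 hB'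
    obtain ⟨hx, hy⟩ := Prod.mk.inj h
    refine Units.ext (Matrix.ext (Fin.forall_fin_two.2 ⟨Fin.forall_fin_two.2 ⟨hx, hy⟩,
      Fin.forall_fin_two.2 ⟨?_, ?_⟩⟩))
    · rw [h₀, h₀', hx, hy]
    · rw [h₁, h₁', hx, hy]
  · rintro ⟨x, y⟩ h
    let B : Matrix (Fin 2) (Fin 2) ℤ := !![x, y; -x * M 1 1 + y * M 1 0, x * M 0 1 - y * M 0 0]
    have hB : B * M = companionMatrix M.trace M.det * B :=
      mul_eq_companionMatrix_mul_iff.2 ⟨rfl, rfl⟩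
    obtain ⟨U, hU⟩ : IsUnit B := by
      rw [Matrix.isUnit_iff_isUnit_det, det_eq_associatedForm_of_mul_eq hB]
      exact Int.isUnit_iff.2 h
    exact ⟨U, by rwa [Set.mem_ofPred_eq, hU], by simp [hU, B]⟩

theorem algebraicallyConjugate_companionMatrix_iff (M : Matrix (Fin 2) (Fin 2) ℤ) :
    AlgebraicallyConjugate M (companionMatrix M.trace M.det) ↔
      ∃ x y : ℤ, associatedForm M x y = 1 ∨ associatedForm M x y = -1 := by
  constructor
  · rintro ⟨B, hB⟩
    exact ⟨_, _, (bijOn_conjugates M).mapsTo hB⟩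
  · rintro ⟨x, y, h⟩
    obtain ⟨B, hB, -⟩ := (bijOn_conjugates M).surjOn (show (x, y) ∈ _ from h)
    exact ⟨B, hB⟩

theorem second_row_of_conjugates {M B : GL (Fin 2) ℤ}
    (h : Conjugates B (M : Matrix (Fin 2) (Fin 2) ℤ)
      (companionMatrix (M : Matrix (Fin 2) (Fin 2) ℤ).trace (M : Matrix (Fin 2) (Fin 2) ℤ).det)) :
    (B : Matrix (Fin 2) (Fin 2) ℤ) 1 =
      (-(M : Matrix (Fin 2) (Fin 2) ℤ).det) • Matrix.vecMul ((B : Matrix (Fin 2) (Fin 2) ℤ) 0)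
        ((M⁻¹ : GL (Fin 2) ℤ) : Matrix (Fin 2) (Fin 2) ℤ) := by
  obtain ⟨h₀, h₁⟩ := mul_eq_companionMatrix_mul_iff.1 (conjugates_iff_mul_eq_mul.1 h)
  have hinv : (M : Matrix (Fin 2) (Fin 2) ℤ).det •
      ((M⁻¹ : GL (Fin 2) ℤ) : Matrix (Fin 2) (Fin 2) ℤ) =
        (M : Matrix (Fin 2) (Fin 2) ℤ).adjugate := by
    rw [Matrix.coe_units_inv, Matrix.inv_def, smul_smul, Ring.mul_inverse_cancel _
      ((Matrix.isUnit_iff_isUnit_det _).1 M.isUnit), one_smul]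
  rw [neg_smul, ← Matrix.vecMul_smul, hinv, Matrix.adjugate_fin_two]
  funext j
  fin_cases j
  · simp only [Fin.zero_eta, h₀, Pi.neg_apply, Matrix.vecMul, dotProduct, Fin.sum_univ_two,
      Matrix.of_apply, Matrix.cons_val', Matrix.cons_val_zero, Matrix.cons_val_one,
      Matrix.cons_val_fin_one]
    ring
  · simp only [Fin.mk_one, h₁, Pi.neg_apply, Matrix.vecMul, dotProduct, Fin.sum_univ_two,
      Matrix.of_apply, Matrix.cons_val', Matrix.cons_val_zero, Matrix.cons_val_one,
      Matrix.cons_val_fin_one]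
    ring

lemma associatedForm_neg (M : Matrix (Fin 2) (Fin 2) ℤ) (x y : ℤ) :
    associatedForm (-M) x y = -associatedForm M x y := by
  simp only [associatedForm, Matrix.neg_apply]
  ring

/-! ### Expansions in a real base -/

lemma zero_mem_upperBounds_of_contracting {S : Set ℝ} (hS : BddAbove S) {ρ : ℝ} (hρ : ρ < 1)
    (h : ∀ E ∈ upperBounds S, 0 ≤ E → ρ * E ∈ upperBounds S) : (0 : ℝ) ∈ upperBounds S := by
  intro x hx
  by_contra! hx0
  have hlub := isLUB_csSup ⟨x, hx⟩ hS
  have hpos : 0 < sSup S := hx0.trans_le (hlub.1 hx)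
  have := hlub.2 (h _ hlub.1 hpos.le)
  nlinarith

section Tail

variable {G : Type*} [AddMonoidWithOne G]

/-- The one-sided sequence `e n, e (n + 1), …`. The index set `G` stands for `ℕ` or `ℤ`, so that
one-sided and two-sided sequences are treated alike. -/
def tail (e : G → ℕ) (n : G) : ℕ → ℕ := fun i => e (n + i)

lemma tail_apply (e : G → ℕ) (n : G) (i : ℕ) : tail e n i = e (n + i) := rfl

lemma tail_tail (e : G → ℕ) (n : G) (k : ℕ) : tail (tail e n) k = tail e (n + k) := by
  funext i
  simp only [tail_apply, Nat.cast_add, Nat.cast_id, add_assoc]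

@[simp] lemma tail_zero (a : ℕ → ℕ) : tail a 0 = a := by
  funext i
  simp only [tail_apply, Nat.cast_id, zero_add]

lemma tail_one_add (a : ℕ → ℕ) (i : ℕ) : tail a 1 i = a (i + 1) := by
  rw [tail_apply, Nat.cast_id, add_comm]

/-- Parry's condition: no tail of `e` exceeds `q` lexicographically. -/
def Admissible (q : ℕ → ℕ) (e : G → ℕ) : Prop := ∀ n, toLex (tail e n) ≤ toLex q

namespace Admissible

variable {q : ℕ → ℕ} {e : G → ℕ} (h : Admissible q e)

include h

lemma tail (n : G) : Admissible q (tail e n) := fun k => by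
  rw [tail_tail]
  exact h (n + k)

lemma le_zero (n : G) : e n ≤ q 0 := by
  by_contra! hlt
  refine (h n).not_gt ⟨0, fun i hi => absurd hi i.not_lt_zero, ?_⟩
  simpa [tail_apply] using hlt

end Admissible

end Tail

/-- The value `∑_{k ≥ 0} a_k β^{-(k+1)}` of a one-sided sequence of digits in base `β`. -/
def value (β : ℝ) (a : ℕ → ℕ) : ℝ := ∑' k : ℕ, (a k : ℝ) * (β ^ (k + 1))⁻¹

/-- The series that defines `value β a` converges. -/
def SummableValue (β : ℝ) (a : ℕ → ℕ) : Prop := Summable fun k : ℕ => (a k : ℝ) * (β ^ (k + 1))⁻¹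

section Value

variable {β : ℝ} {a b : ℕ → ℕ}

lemma value_nonneg (hβ : 0 ≤ β) (a : ℕ → ℕ) : 0 ≤ value β a :=
  tsum_nonneg fun k => by positivity

lemma hasSum_inv_pow_succ (hβ : 1 < β) : HasSum (fun k : ℕ => (β ^ (k + 1))⁻¹) (β - 1)⁻¹ := by
  have h := (hasSum_geometric_of_lt_one (inv_nonneg.2 (zero_le_one.trans hβ.le))
    (inv_lt_one_of_one_lt₀ hβ)).mul_left β⁻¹
  have hlim : β⁻¹ * (1 - β⁻¹)⁻¹ = (β - 1)⁻¹ := by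
    rw [← mul_inv, mul_sub, mul_one, mul_inv_cancel₀ (by positivity)]
  rw [hlim] at h
  simpa only [pow_succ', mul_inv, inv_pow] using h

lemma summableValue_of_le (hβ : 1 < β) {R : ℕ} (hR : ∀ k, a k ≤ R) : SummableValue β a :=
  .of_nonneg_of_le (fun k => by positivity) (fun k => by gcongr; exact hR k)
    ((hasSum_inv_pow_succ hβ).summable.mul_left (R : ℝ))

lemma value_le (hβ : 1 < β) {R : ℕ} (hR : ∀ k, a k ≤ R) : value β a ≤ R * (β - 1)⁻¹ := by
  rw [← (hasSum_inv_pow_succ hβ).tsum_eq, ← tsum_mul_left]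
  exact (summableValue_of_le hβ hR).tsum_le_tsum (fun k => by gcongr; exact hR k)
    ((hasSum_inv_pow_succ hβ).summable.mul_left (R : ℝ))

lemma SummableValue.tail (hβ : β ≠ 0) (ha : SummableValue β a) (n : ℕ) :
    SummableValue β (tail a n) := by
  refine (((summable_nat_add_iff n).2 ha).mul_left (β ^ n)).congr fun k => ?_
  rw [tail_apply, Nat.cast_id, add_comm k n, add_assoc, pow_add]
  field_simp

lemma SummableValue.mul_value (hβ : β ≠ 0) (ha : SummableValue β a) :
    β * value β a = a 0 + value β (ToralCoding.tail a 1) := by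
  rw [value, ha.tsum_eq_zero_add, mul_add, ← tsum_mul_left, value]
  congr 1
  · field_simp
    ring
  · refine tsum_congr fun k => ?_
    rw [tail_one_add]
    field_simp
    ring

lemma SummableValue.mul_value_tail (hβ : β ≠ 0) (ha : SummableValue β a) (n : ℕ) :
    β * value β (ToralCoding.tail a n) = a n + value β (ToralCoding.tail a (n + 1)) := by
  rw [(ha.tail hβ n).mul_value hβ, tail_tail]
  rfl

lemma value_sub_value (hβ : β ≠ 0) (ha : SummableValue β a) (hb : SummableValue β b) {j : ℕ}
    (h : ∀ i < j, a i = b i) :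
    value β a - value β b = (β ^ j)⁻¹ * (value β (tail a j) - value β (tail b j)) := by
  induction j with
  | zero => simp
  | succ j ih =>
    have hA := ha.mul_value_tail hβ j
    have hB := hb.mul_value_tail hβ j
    rw [ih fun i hi => h i (hi.trans j.lt_succ_self), ← sub_eq_iff_eq_add'.2 hA,
      ← sub_eq_iff_eq_add'.2 hB, h j j.lt_succ_self, pow_succ]
    field_simp
    ring

lemma value_sub_value_of_succ (hβ : β ≠ 0) (ha : SummableValue β a) (hb : SummableValue β b)
    {j : ℕ} (h : ∀ i < j, a i = b i) :
    value β a - value β b = (β ^ (j + 1))⁻¹ *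
      ((a j : ℝ) - b j + (value β (tail a (j + 1)) - value β (tail b (j + 1)))) := by
  have hA := ha.mul_value_tail hβ j
  have hB := hb.mul_value_tail hβ j
  rw [value_sub_value hβ ha hb h, ← sub_eq_iff_eq_add'.2 hA, ← sub_eq_iff_eq_add'.2 hB, pow_succ]
  field_simp
  ring

lemma value_lt_value (hβ : 0 < β) (ha : SummableValue β a) (hb : SummableValue β b) {j : ℕ}
    (h : ∀ i < j, a i = b i) (hj : a j < b j)
    (htail : value β (tail a (j + 1)) < 1 + value β (tail b (j + 1))) :
    value β a < value β b := by
  have hj' : (a j : ℝ) + 1 ≤ b j := by exact_mod_cast hj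
  rw [← sub_neg, value_sub_value_of_succ hβ.ne' ha hb h]
  exact mul_neg_of_pos_of_neg (by positivity) (by linarith)

lemma value_lt_value_of_toLex_lt (hβ : 0 < β) (ha : SummableValue β a) (hb : SummableValue β b)
    (ha1 : ∀ k, value β (tail a k) ≤ 1) (hb0 : ∀ k, 0 < value β (tail b k))
    (h : toLex a < toLex b) : value β a < value β b := by
  obtain ⟨j, hlt, hj⟩ := h
  exact value_lt_value hβ ha hb hlt hj (by linarith [ha1 (j + 1), hb0 (j + 1)])

lemma value_le_value_of_toLex_le (hβ : 0 < β) (ha : SummableValue β a) (hb : SummableValue β b)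
    (ha1 : ∀ k, value β (tail a k) ≤ 1) (h : toLex a ≤ toLex b) : value β a ≤ value β b := by
  rcases h.eq_or_lt with heq | ⟨j, hlt, hj⟩
  · rw [toLex_inj.1 heq]
  · have hj' : (a j : ℝ) + 1 ≤ b j := by exact_mod_cast hj
    rw [← sub_nonpos, value_sub_value_of_succ hβ.ne' ha hb hlt]
    exact mul_nonpos_of_nonneg_of_nonpos (by positivity)
      (by linarith [ha1 (j + 1), value_nonneg hβ.le (tail b (j + 1))])

/-- The remainders of an expansion algorithm that stay bounded are the values of the tails of the
sequence of digits it produces. -/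
lemma hasSum_of_recurrence (hβ : 1 < β) {t : ℕ → ℝ} {C : ℝ} (ht : ∀ n, |t n| ≤ C)
    (hrec : ∀ n, t (n + 1) = β * t n - a n) :
    HasSum (fun k : ℕ => (a k : ℝ) * (β ^ (k + 1))⁻¹) (t 0) := by
  have hpartial (n : ℕ) :
      ∑ k ∈ Finset.range n, (a k : ℝ) * (β ^ (k + 1))⁻¹ = t 0 - β⁻¹ ^ n * t n := by
    induction n with
    | zero => simp
    | succ n ih =>
      rw [Finset.sum_range_succ, ih, hrec, inv_pow, inv_pow, pow_succ]
      field_simp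
      ring
  rw [hasSum_iff_tendsto_nat_of_nonneg fun k => by positivity]
  simp only [hpartial]
  have hpow := tendsto_pow_atTop_nhds_zero_of_lt_one (inv_nonneg.2 (zero_le_one.trans hβ.le))
    (inv_lt_one_of_one_lt₀ hβ)
  simpa using (hpow.zero_mul_isBoundedUnder_le (isBoundedUnder_of ⟨C, ht⟩)).const_sub (t 0)

lemma value_tail_of_recurrence (hβ : 1 < β) {t : ℕ → ℝ} {C : ℝ} (ht : ∀ n, |t n| ≤ C)
    (hrec : ∀ n, t (n + 1) = β * t n - a n) (n : ℕ) : value β (tail a n) = t n :=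
  (hasSum_of_recurrence (t := fun k => t (n + k)) hβ (fun k => ht (n + k))
    fun k => hrec (n + k)).tsum_eq

/-- The digits are recovered by the greedy algorithm. -/
lemma eq_of_value_eq (hβ : 0 < β) (ha : SummableValue β a) (hb : SummableValue β b)
    (ha1 : ∀ k, value β (tail a k) < 1) (hb1 : ∀ k, value β (tail b k) < 1)
    (h : value β a = value β b) : a = b := by
  have hfloor {c : ℕ → ℕ} (hc : SummableValue β c) (hc1 : ∀ k, value β (tail c k) < 1) (k : ℕ) :
      ⌊β * value β (tail c k)⌋₊ = c k := by
    have h0 := value_nonneg hβ.le (tail c (k + 1))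
    rw [hc.mul_value_tail hβ.ne' k, Nat.floor_eq_iff (by positivity)]
    exact ⟨by linarith, by linarith [hc1 (k + 1)]⟩
  have htails (k : ℕ) : value β (tail a k) = value β (tail b k) := by
    induction k with
    | zero => simpa only [tail_zero] using h
    | succ k ih =>
      have hdigit : a k = b k := by rw [← hfloor ha ha1 k, ← hfloor hb hb1 k, ih]
      have hA := ha.mul_value_tail hβ.ne' k
      have hB := hb.mul_value_tail hβ.ne' k
      rw [ih, hdigit] at hA
      linarith
  funext k
  rw [← hfloor ha ha1 k, ← hfloor hb hb1 k, htails k]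

theorem exists_greedy_expansion (hβ : 1 < β) {x : ℝ} (hx : x ∈ Set.Ico (0 : ℝ) 1) :
    ∃ a : ℕ → ℕ, SummableValue β a ∧ (∀ k, value β (tail a k) < 1) ∧ value β a = x := by
  let y : ℕ → ℝ := fun n => (fun z => Int.fract (β * z))^[n] x
  have hy (n : ℕ) : y n ∈ Set.Ico (0 : ℝ) 1 := by
    cases n with
    | zero => exact hx
    | succ n =>
      simp only [y, Function.iterate_succ_apply']
      exact ⟨Int.fract_nonneg _, Int.fract_lt_one _⟩
  have hrec (n : ℕ) : y (n + 1) = β * y n - (⌊β * y n⌋₊ : ℕ) := by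
    have : 0 ≤ β * y n := mul_nonneg (by linarith) (hy n).1
    simp only [y, Function.iterate_succ_apply']
    rw [Int.fract, natCast_floor_eq_intCast_floor this]
  have hbdd (n : ℕ) : |y n| ≤ 1 := abs_le.2 ⟨by linarith [(hy n).1], (hy n).2.le⟩
  have htail := value_tail_of_recurrence hβ hbdd hrec
  exact ⟨fun n => ⌊β * y n⌋₊, (hasSum_of_recurrence hβ hbdd hrec).summable,
    fun k => (htail k).trans_lt (hy k).2, (hasSum_of_recurrence hβ hbdd hrec).tsum_eq⟩

end Value

/-- Concatenation of the first `n` digits of `a` with `v`. -/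
def splice (a : ℕ → ℕ) (n : ℕ) (v : ℕ → ℕ) : ℕ → ℕ := fun i => if i < n then a i else v (i - n)

section Splice

variable {a v : ℕ → ℕ} {n k : ℕ}

lemma splice_of_lt (hk : k < n) : splice a n v k = a k := if_pos hk

lemma tail_splice (hk : k ≤ n) : tail (splice a n v) k = splice (tail a k) (n - k) v := by
  funext i
  have hiff : k + i < n ↔ i < n - k := by omega
  have hsub : k + i - n = i - (n - k) := by omega
  simp only [tail_apply, Nat.cast_id, splice, hiff, hsub]

lemma splice_zero : splice a 0 v = v := by
  funext i
  simp [splice]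

lemma tail_splice_self : tail (splice a n v) n = v := by
  rw [tail_splice le_rfl, Nat.sub_self, splice_zero]

lemma SummableValue.splice {β : ℝ} (hv : SummableValue β v) :
    SummableValue β (splice a n v) := by
  refine (summable_nat_add_iff n).1 ((hv.mul_left (β ^ n)⁻¹).congr fun k => ?_)
  rw [ToralCoding.splice, if_neg (by omega), Nat.add_sub_cancel, add_right_comm, pow_add, mul_inv,
    add_comm k 1, add_comm 1 k]
  ring

end Splice

/-- `q` is the quasi-greedy expansion of one in base `β`, and the values of its tails are bounded
away from zero (which holds whenever they take finitely many values). -/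
structure QuasiGreedy (β : ℝ) (q : ℕ → ℕ) : Prop where
  one_lt : 1 < β
  summable : SummableValue β q
  value_eq_one : value β q = 1
  exists_pos_le_value_tail : ∃ c > 0, ∀ n, c ≤ value β (tail q n)
  value_tail_le_one : ∀ n, value β (tail q n) ≤ 1

namespace QuasiGreedy

variable {β : ℝ} {q a : ℕ → ℕ} (H : QuasiGreedy β q)

include H

lemma pos : 0 < β := one_pos.trans H.one_lt

lemma value_tail_pos (n : ℕ) : 0 < value β (tail q n) := by
  obtain ⟨c, hc, h⟩ := H.exists_pos_le_value_tail
  exact hc.trans_le (h n)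

lemma value_tail_one : value β (tail q 1) = β - q 0 := by
  have := H.summable.mul_value H.pos.ne'
  rw [H.value_eq_one] at this
  linarith

lemma one_le_zero : 1 ≤ q 0 := by
  have : (0 : ℝ) < q 0 := by linarith [H.value_tail_one, H.value_tail_le_one 1, H.one_lt]
  exact_mod_cast this

lemma summable_of_admissible (h : Admissible q a) : SummableValue β a :=
  summableValue_of_le H.one_lt h.le_zero

/-- The excess over one of the values of the tails contracts by the factor `β⁻¹`: a tail either is
`q` or has a digit smaller than that of `q`, which costs more than it can gain later. -/
theorem value_tail_le_one_of_admissible (h : Admissible q a) (k : ℕ) :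
    value β (tail a k) ≤ 1 := by
  have hβ := H.one_lt
  have ha := H.summable_of_admissible h
  let S : Set ℝ := Set.range fun k => value β (tail a k) - 1
  have hbdd : BddAbove S := by
    refine ⟨q 0 * (β - 1)⁻¹ - 1, ?_⟩
    rintro _ ⟨k, rfl⟩
    exact sub_le_sub_right (value_le hβ fun i => (h.tail k).le_zero i) 1
  refine sub_nonpos.1 (zero_mem_upperBounds_of_contracting hbdd (inv_lt_one_of_one_lt₀ hβ)
    (fun E hE hE0 => ?_) ⟨k, rfl⟩)
  rintro _ ⟨k, rfl⟩
  change value β (tail a k) - 1 ≤ β⁻¹ * E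
  rcases (h k).eq_or_lt with heq | ⟨j, hlt, hj⟩
  · rw [toLex_inj.1 heq, H.value_eq_one, sub_self]
    positivity
  · have hsub := value_sub_value_of_succ H.pos.ne' (ha.tail H.pos.ne' k) H.summable hlt
    rw [H.value_eq_one, tail_tail] at hsub
    have hj' : (tail a k j : ℝ) + 1 ≤ q j := by exact_mod_cast hj
    have hE' : value β (tail a (k + (j + 1))) - 1 ≤ E := hE ⟨k + (j + 1), rfl⟩
    have hpos := H.value_tail_pos (j + 1)
    calc value β (tail a k) - 1 ≤ (β ^ (j + 1))⁻¹ * E := by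
          rw [hsub]
          exact mul_le_mul_of_nonneg_left (by simpa using by linarith) (by positivity)
      _ ≤ β⁻¹ * E := by
          gcongr
          exact le_self_pow₀ hβ.le j.succ_ne_zero

lemma value_le_value_tail (h : Admissible q a) {n : ℕ} (hn : toLex a ≤ toLex (tail q n)) :
    value β a ≤ value β (tail q n) :=
  value_le_value_of_toLex_le H.pos (H.summable_of_admissible h) (H.summable.tail H.pos.ne' n)
    (H.value_tail_le_one_of_admissible h) hn

lemma value_lt_one (h : Admissible q a) (hlt : toLex a < toLex q) : value β a < 1 :=
  H.value_eq_one ▸ value_lt_value_of_toLex_lt H.pos (H.summable_of_admissible h) H.summable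
    (H.value_tail_le_one_of_admissible h) H.value_tail_pos hlt

lemma toLex_lt_of_value_lt_one (ha : SummableValue β a) (h : value β a < 1) :
    toLex a < toLex q := by
  by_contra hle
  exact h.not_ge (H.value_eq_one ▸
    value_le_value_of_toLex_le H.pos H.summable ha H.value_tail_le_one (not_lt.1 hle))

theorem value_splice_lt_one {v : ℕ → ℕ} (hv : SummableValue β v)
    (hlt : ∀ k, value β v < value β (tail q k)) (h : Admissible q a) (n : ℕ) :
    value β (splice a n v) < 1 := by
  induction n using Nat.strong_induction_on generalizing a with
  | _ n ih =>
  have hs := hv.splice (a := a) (n := n)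
  rw [← H.value_eq_one]
  by_cases hagree : ∀ i < n, splice a n v i = q i
  · rw [← sub_neg, value_sub_value H.pos.ne' hs H.summable hagree, tail_splice_self]
    have := H.pos
    exact mul_neg_of_pos_of_neg (by positivity) (sub_neg.2 (hlt n))
  · push Not at hagree
    obtain ⟨j, ⟨hjn, hne⟩, hmin⟩ := Nat.findX hagree
    have heq : ∀ i < j, splice a n v i = q i := fun i hi => by
      by_contra hne'
      exact hmin i hi ⟨hi.trans hjn, hne'⟩
    have hlt_digit : splice a n v j < q j := by
      refine hne.lt_of_le (not_lt.1 fun hgt => (h 0).not_gt ?_)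
      rw [tail_zero]
      refine ⟨j, fun i hi => ?_, by rwa [splice_of_lt hjn] at hgt⟩
      exact (splice_of_lt (v := v) (hi.trans hjn) ▸ heq i hi).symm
    refine value_lt_value H.pos hs H.summable heq hlt_digit ?_
    rw [tail_splice hjn]
    linarith [ih (n - (j + 1)) (by omega) (h.tail (j + 1)), H.value_tail_pos (j + 1)]

end QuasiGreedy

/-! ### Quadratic units -/

/-- `β > 1` and `μ` are the two roots of `X² - r X + σ`, where `σ = ±1`. -/
structure IsUnitPair (β μ : ℝ) (r σ : ℤ) : Prop where
  one_lt : 1 < β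
  add_eq : β + μ = r
  mul_eq : β * μ = σ
  isUnit_norm : IsUnit σ

/-- The image of `ℤ[β]` under its two embeddings into the real numbers. -/
def conjLattice (β μ : ℝ) : AddSubgroup (ℝ × ℝ) where
  carrier := {p | ∃ a b : ℤ, p.1 = a + b * β ∧ p.2 = a + b * μ}
  zero_mem' := ⟨0, 0, by simp, by simp⟩
  add_mem' := by
    rintro p p' ⟨a, b, h₁, h₂⟩ ⟨a', b', h₁', h₂'⟩
    refine ⟨a + a', b + b', ?_, ?_⟩ <;> push_cast
    · rw [Prod.fst_add, h₁, h₁']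
      ring
    · rw [Prod.snd_add, h₂, h₂']
      ring
  neg_mem' := by
    rintro p ⟨a, b, h₁, h₂⟩
    refine ⟨-a, -b, ?_, ?_⟩ <;> push_cast
    · rw [Prod.fst_neg, h₁]
      ring
    · rw [Prod.snd_neg, h₂]
      ring

lemma intCast_mem_conjLattice (β μ : ℝ) (a : ℤ) : ((a : ℝ), (a : ℝ)) ∈ conjLattice β μ :=
  ⟨a, 0, by simp, by simp⟩

lemma eq_zero_of_add_mul_eq_zero {x : ℝ} (hx : Irrational x) {a b : ℤ}
    (h : (a : ℝ) + b * x = 0) : a = 0 ∧ b = 0 := by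
  by_cases hb : b = 0
  · exact ⟨by simpa [hb] using h, hb⟩
  · exact absurd h ((hx.intCast_mul hb).intCast_add a).ne_zero

namespace IsUnitPair

variable {β μ : ℝ} {r σ : ℤ} (H : IsUnitPair β μ r σ)

include H

lemma pos : 0 < β := one_pos.trans H.one_lt

lemma abs_eq : |μ| = β⁻¹ := by
  have h : |β * μ| = 1 := by
    rw [H.mul_eq, ← Int.cast_abs, Int.isUnit_iff_abs_eq.1 H.isUnit_norm, Int.cast_one]
  rw [abs_mul, abs_of_pos H.pos] at h
  exact eq_inv_of_mul_eq_one_right h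

lemma abs_lt_one : |μ| < 1 := by
  rw [H.abs_eq]
  exact inv_lt_one_of_one_lt₀ H.one_lt

lemma sub_pos : 0 < β - μ := by
  linarith [H.one_lt, (abs_lt.1 H.abs_lt_one).2]

lemma ne_conj : β ≠ μ := (_root_.sub_pos.1 H.sub_pos).ne'

lemma ne_zero : μ ≠ 0 := by
  rw [← abs_pos, H.abs_eq]
  exact inv_pos.2 H.pos

lemma trace_pos : 0 < r := by
  have : (0 : ℝ) < r := by linarith [H.one_lt, (abs_lt.1 H.abs_lt_one).1, H.add_eq]
  exact_mod_cast this

/-- A rational root of the monic polynomial `X² - r X + σ` would be an integer dividing `σ`. -/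
lemma irrational : Irrational β := by
  rintro ⟨q, hq⟩
  have hroot : q ^ 2 - r * q + σ = 0 := by
    have : (q : ℝ) ^ 2 - r * q + σ = 0 := by
      rw [hq, ← H.add_eq, ← H.mul_eq]
      ring
    exact_mod_cast this
  have hintegral : IsIntegral ℤ q := by
    refine ⟨.X ^ 2 - .C r * .X + .C σ, by monicity!, ?_⟩
    rw [← Polynomial.aeval_def]
    simpa using hroot
  obtain ⟨n, rfl⟩ := IsIntegrallyClosed.isIntegral_iff.1 hintegral
  have hmul : n * (r - n) = σ := by
    have : (n : ℚ) ^ 2 - r * n + σ = 0 := by simpa using hroot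
    have : n ^ 2 - r * n + σ = 0 := by exact_mod_cast this
    linarith
  have hn : |n| = 1 := Int.isUnit_iff_abs_eq.1 (isUnit_of_mul_isUnit_left (hmul ▸ H.isUnit_norm))
  have hβ : β = n := by simpa using hq.symm
  refine H.one_lt.ne' ?_
  rw [← abs_of_pos H.pos, hβ, ← Int.cast_abs, hn, Int.cast_one]

lemma irrational_conj : Irrational μ := by
  rw [← sub_eq_iff_eq_add'.2 H.add_eq.symm]
  exact H.irrational.intCast_sub r

lemma mul_mem_conjLattice {u v : ℝ} (h : (u, v) ∈ conjLattice β μ) :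
    (β * u, μ * v) ∈ conjLattice β μ := by
  obtain ⟨a, b, rfl, rfl⟩ := h
  refine ⟨-b * σ, a + b * r, ?_, ?_⟩ <;>
  · push_cast
    rw [← H.add_eq, ← H.mul_eq]
    ring

lemma pow_mul_mem_conjLattice {u v : ℝ} (h : (u, v) ∈ conjLattice β μ) (n : ℕ) :
    (β ^ n * u, μ ^ n * v) ∈ conjLattice β μ := by
  induction n with
  | zero => simpa using h
  | succ n ih => simpa only [pow_succ', mul_assoc] using H.mul_mem_conjLattice ih

lemma mem_conjLattice_iff {p : ℝ × ℝ} :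
    p ∈ conjLattice β μ ↔ (p.1 - p.2) / (β - μ) ∈ Set.range (Int.cast : ℤ → ℝ) ∧
      p.1 - (p.1 - p.2) / (β - μ) * β ∈ Set.range (Int.cast : ℤ → ℝ) := by
  have hs := H.sub_pos.ne'
  constructor
  · rintro ⟨a, b, h₁, h₂⟩
    have hb : (p.1 - p.2) / (β - μ) = b := by
      rw [div_eq_iff hs, h₁, h₂]
      ring
    rw [hb, h₁]
    exact ⟨⟨b, rfl⟩, a, by ring⟩
  · rintro ⟨⟨b, hb⟩, a, ha⟩
    have hsub : (p.1 - p.2) = b * (β - μ) := (div_eq_iff hs).1 hb.symm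
    rw [← hb] at ha
    exact ⟨a, b, by linarith, by linarith⟩

lemma isClosed_conjLattice : IsClosed (conjLattice β μ : Set (ℝ × ℝ)) := by
  have hZ := Int.isClosedEmbedding_coe_real.isClosed_range
  have heq : (conjLattice β μ : Set (ℝ × ℝ)) =
      (fun p => (p.1 - p.2) / (β - μ)) ⁻¹' Set.range (Int.cast : ℤ → ℝ) ∩
        (fun p => p.1 - (p.1 - p.2) / (β - μ) * β) ⁻¹' Set.range (Int.cast : ℤ → ℝ) :=
    Set.ext fun _ => H.mem_conjLattice_iff
  rw [heq]
  exact (hZ.preimage (by fun_prop)).inter (hZ.preimage (by fun_prop))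

lemma eq_zero_of_mem_conjLattice {u : ℝ} (h : (u, (0 : ℝ)) ∈ conjLattice β μ) : u = 0 := by
  obtain ⟨a, b, h₁, h₂⟩ := h
  obtain ⟨rfl, rfl⟩ := eq_zero_of_add_mul_eq_zero H.irrational_conj h₂.symm
  simpa using h₁

end IsUnitPair

lemma QuasiGreedy.of_recurrence {β : ℝ} {q : ℕ → ℕ} {t : ℕ → ℝ} {c : ℝ} (hβ : 1 < β)
    (h0 : t 0 = 1) (hc : 0 < c) (hct : ∀ n, c ≤ t n) (ht : ∀ n, t n ≤ 1)
    (hrec : ∀ n, t (n + 1) = β * t n - q n) : QuasiGreedy β q := by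
  have hbdd (n : ℕ) : |t n| ≤ 1 := abs_le.2 ⟨by linarith [hct n], ht n⟩
  have htail := value_tail_of_recurrence hβ hbdd hrec
  have hsum := hasSum_of_recurrence hβ hbdd hrec
  exact ⟨hβ, hsum.summable, hsum.tsum_eq.trans h0, ⟨c, hc, fun n => (htail n).symm ▸ hct n⟩,
    fun n => (htail n).trans_le (ht n)⟩

/-- The digits of the quasi-greedy expansion of one in base `β`: they are `r - 1, r - 2, r - 2, …`
when `σ = 1` and `r, 0, r, 0, …` when `σ = -1`. -/
def quasiGreedyDigits (r σ : ℤ) (n : ℕ) : ℕ :=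
  if σ = 1 then (if n = 0 then (r - 1).toNat else (r - 2).toNat)
  else (if Even n then r.toNat else 0)

namespace IsUnitPair

section NormOne

variable {β μ : ℝ} {r : ℤ} (H : IsUnitPair β μ r 1)

include H

lemma mul_conj_eq_one : β * μ = 1 := H.mul_eq.trans Int.cast_one

lemma conj_pos : 0 < μ := pos_of_mul_pos_right (H.mul_conj_eq_one ▸ one_pos) H.pos.le

lemma three_le_trace : 3 ≤ r := by
  have h : (2 : ℝ) < r := by
    rw [← H.add_eq]
    nlinarith [H.mul_conj_eq_one, H.one_lt, H.conj_pos, mul_pos H.sub_pos H.sub_pos]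
  exact_mod_cast h

lemma quasiGreedy_of_norm_one : QuasiGreedy β (quasiGreedyDigits r 1) := by
  have hr := H.three_le_trace
  have hμ := H.conj_pos
  have hμ1 := (abs_lt.1 H.abs_lt_one).2
  refine .of_recurrence (t := fun n => if n = 0 then 1 else 1 - μ) (c := 1 - μ) H.one_lt
    (if_pos rfl) (by linarith) (fun n => ?_) (fun n => ?_) fun n => ?_
  · split_ifs <;> linarith
  · split_ifs <;> linarith
  · have h₁ : (((r - 1).toNat : ℕ) : ℝ) = r - 1 := by
      rw [← Int.cast_natCast, Int.toNat_of_nonneg (by omega)]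
      push_cast
      rfl
    have h₂ : (((r - 2).toNat : ℕ) : ℝ) = r - 2 := by
      rw [← Int.cast_natCast, Int.toNat_of_nonneg (by omega)]
      push_cast
      rfl
    simp only [quasiGreedyDigits, if_true, if_neg n.succ_ne_zero]
    split_ifs
    · linarith [H.add_eq]
    · linarith [H.add_eq, H.mul_conj_eq_one]

end NormOne

section NormNegOne

variable {β μ : ℝ} {r : ℤ} (H : IsUnitPair β μ r (-1))

include H

lemma mul_conj_eq_neg_one : β * μ = -1 := H.mul_eq.trans (by simp)

lemma conj_neg : μ < 0 := by
  by_contra! h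
  linarith [H.mul_conj_eq_neg_one, mul_nonneg H.pos.le h]

lemma quasiGreedy_of_norm_neg_one : QuasiGreedy β (quasiGreedyDigits r (-1)) := by
  have hr := H.trace_pos
  have hμ := H.conj_neg
  have hμ1 := (abs_lt.1 H.abs_lt_one).1
  refine .of_recurrence (t := fun n => if Even n then 1 else -μ) (c := -μ) H.one_lt
    (if_pos Even.zero) (by linarith) (fun n => ?_) (fun n => ?_) fun n => ?_
  · split_ifs <;> linarith
  · split_ifs <;> linarith
  · have h₁ : ((r.toNat : ℕ) : ℝ) = r := by
      rw [← Int.cast_natCast, Int.toNat_of_nonneg hr.le]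
    have hne : (-1 : ℤ) ≠ 1 := by decide
    simp only [quasiGreedyDigits, if_neg hne]
    rcases n.even_or_odd with hn | hn
    · simp only [Nat.even_add_one, hn, not_true, if_true, if_false, h₁]
      linarith [H.add_eq]
    · simp only [Nat.even_add_one, Nat.not_even_iff_odd.2 hn, not_false_iff, if_true, if_false,
        Nat.cast_zero]
      linarith [H.mul_conj_eq_neg_one]

end NormNegOne

lemma quasiGreedy {β μ : ℝ} {r σ : ℤ} (H : IsUnitPair β μ r σ) :
    QuasiGreedy β (quasiGreedyDigits r σ) := by
  rcases Int.isUnit_iff.1 H.isUnit_norm with rfl | rfl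
  exacts [H.quasiGreedy_of_norm_one, H.quasiGreedy_of_norm_neg_one]

end IsUnitPair

/-! ### Futures and pasts of two-sided sequences -/

/-- The value `∑_{k ≥ 1} e_{n+k} β^{-k}` of the future at time `n`. -/
def future (β : ℝ) (e : ℤ → ℕ) (n : ℤ) : ℝ := value β (tail e (n + 1))

/-- The value `-∑_{k ≥ 0} e_{n-k} μ^k` of the past at time `n`. The sign makes `μ` act on it in
the same way as `β` acts on the future. -/
def past (μ : ℝ) (e : ℤ → ℕ) (n : ℤ) : ℝ := -∑' k : ℕ, (e (n - k) : ℝ) * μ ^ k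

section FuturePast

variable {β μ : ℝ} {e : ℤ → ℕ}

lemma mul_future (hβ : β ≠ 0) {n : ℤ} (h : SummableValue β (tail e (n + 1))) :
    β * future β e n = e (n + 1) + future β e (n + 1) := by
  rw [future, h.mul_value hβ, tail_tail, tail_apply, Nat.cast_zero, add_zero, Nat.cast_one, future]

lemma past_add_one {n : ℤ} (h : Summable fun k : ℕ => (e (n - k) : ℝ) * μ ^ k) :
    past μ e (n + 1) = μ * past μ e n - e (n + 1) := by
  have hterm (k : ℕ) : (e (n + 1 - ((k + 1 : ℕ) : ℤ)) : ℝ) * μ ^ (k + 1) =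
      μ * ((e (n - k) : ℝ) * μ ^ k) := by
    rw [Nat.cast_add_one, add_sub_add_right_eq_sub, pow_succ]
    ring
  have hsum : Summable fun k : ℕ => (e (n + 1 - k) : ℝ) * μ ^ k := by
    refine (summable_nat_add_iff 1).1 ?_
    simp only [hterm]
    exact h.mul_left μ
  rw [past, hsum.tsum_eq_zero_add]
  simp only [hterm, tsum_mul_left, past, Nat.cast_zero, sub_zero, pow_zero, mul_one]
  ring

lemma norm_past_term_le {R : ℕ} (hR : ∀ n, e n ≤ R) (n : ℤ) (k : ℕ) :
    ‖(e (n - k) : ℝ) * μ ^ k‖ ≤ R * |μ| ^ k := by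
  rw [norm_mul, norm_pow, Real.norm_natCast, Real.norm_eq_abs]
  gcongr
  exact hR _

lemma summable_past (hμ : |μ| < 1) {R : ℕ} (hR : ∀ n, e n ≤ R) (n : ℤ) :
    Summable fun k : ℕ => (e (n - k) : ℝ) * μ ^ k :=
  .of_norm_bounded ((summable_geometric_of_lt_one (abs_nonneg μ) hμ).mul_left (R : ℝ))
    (norm_past_term_le hR n)

lemma abs_past_le (hμ : |μ| < 1) {R : ℕ} (hR : ∀ n, e n ≤ R) (n : ℤ) :
    |past μ e n| ≤ R * (1 - |μ|)⁻¹ := by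
  rw [past, abs_neg]
  exact tsum_of_norm_bounded ((hasSum_geometric_of_lt_one (abs_nonneg μ) hμ).mul_left (R : ℝ))
    (norm_past_term_le hR n)

lemma tail_comp_add (e : ℤ → ℕ) (m n : ℤ) : tail (fun k => e (k + m)) n = tail e (n + m) := by
  funext i
  simp only [tail_apply, add_right_comm]

lemma Admissible.comp_add {q : ℕ → ℕ} (h : Admissible q e) (m : ℤ) :
    Admissible q fun k => e (k + m) := fun n => by
  rw [tail_comp_add]
  exact h (n + m)

lemma future_comp_add (β : ℝ) (e : ℤ → ℕ) (m n : ℤ) :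
    future β (fun k => e (k + m)) n = future β e (n + m) := by
  rw [future, tail_comp_add, add_right_comm, future]

lemma past_comp_add (μ : ℝ) (e : ℤ → ℕ) (m n : ℤ) :
    past μ (fun k => e (k + m)) n = past μ e (n + m) := by
  simp only [past, sub_add_eq_add_sub]

lemma toLex_tail_one_le {a b : ℕ → ℕ} (h : toLex a ≤ toLex b) (h0 : a 0 = b 0) :
    toLex (tail a 1) ≤ toLex (tail b 1) := by
  by_contra! hlt
  obtain ⟨j, hj, hj'⟩ := hlt
  simp only [Pi.toLex_apply, tail_one_add] at hj hj'
  refine h.not_gt ⟨j + 1, fun i hi => ?_, hj'⟩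
  rcases i with - | i
  exacts [h0.symm, hj i (Nat.lt_of_succ_lt_succ hi)]

end FuturePast

namespace QuasiGreedy

variable {β : ℝ} {q : ℕ → ℕ} (H : QuasiGreedy β q) {e : ℤ → ℕ}

include H

lemma mul_future (h : Admissible q e) (n : ℤ) :
    β * future β e n = e (n + 1) + future β e (n + 1) :=
  ToralCoding.mul_future H.pos.ne' (H.summable_of_admissible (h.tail (n + 1)))

lemma future_nonneg (e : ℤ → ℕ) (n : ℤ) : 0 ≤ future β e n := value_nonneg H.pos.le _

lemma future_le_one (h : Admissible q e) (n : ℤ) : future β e n ≤ 1 := by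
  simpa only [future, tail_zero] using H.value_tail_le_one_of_admissible (h.tail (n + 1)) 0

lemma future_le_of_eq (h : Admissible q e) {n : ℤ} (hn : e n = q 0) : future β e n ≤ β - q 0 := by
  rw [← H.value_tail_one]
  refine H.value_le_value_tail (h.tail (n + 1)) ?_
  have htail : tail (tail e n) 1 = tail e (n + 1) := by rw [tail_tail, Nat.cast_one]
  rw [← htail]
  exact toLex_tail_one_le (h n) (by rw [tail_apply, Nat.cast_zero, add_zero, hn])

end QuasiGreedy

/-- The union of the rectangles `[0, 1] × [1 - β, s]` and `[0, κ] × [-β, 1 - β]`, which for a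
suitable choice of `κ` and `s` contains the pairs (future, past) of the admissible sequences. -/
def rectangles (β κ s : ℝ) : Set (ℝ × ℝ) :=
  Set.Icc 0 1 ×ˢ Set.Icc (1 - β) s ∪ Set.Icc 0 κ ×ˢ Set.Icc (-β) (1 - β)

namespace IsUnitPair

variable {β μ : ℝ} {e : ℤ → ℕ}

lemma past_add_one {r σ : ℤ} (H : IsUnitPair β μ r σ)
    (h : Admissible (quasiGreedyDigits r σ) e) (n : ℤ) :
    past μ e (n + 1) = μ * past μ e n - e (n + 1) :=
  ToralCoding.past_add_one (summable_past H.abs_lt_one h.le_zero n)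

section NormOne

variable {r : ℤ} (H : IsUnitPair β μ r 1)

include H

lemma quasiGreedyDigits_zero_of_norm_one : (quasiGreedyDigits r 1 0 : ℤ) = r - 1 := by
  rw [quasiGreedyDigits, if_pos rfl, if_pos rfl, Int.toNat_of_nonneg]
  linarith [H.three_le_trace]

variable (h : Admissible (quasiGreedyDigits r 1) e)

include h

lemma future_le_of_eq_sub_one {n : ℤ} (hn : (e n : ℤ) = r - 1) : future β e n ≤ 1 - μ := by
  have hq := H.quasiGreedyDigits_zero_of_norm_one
  have hq' : (quasiGreedyDigits r 1 0 : ℝ) = r - 1 := by exact_mod_cast hq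
  refine (H.quasiGreedy.future_le_of_eq h (n := n) (by omega)).trans_eq ?_
  rw [hq', ← H.add_eq]
  ring

lemma one_sub_conj_lt_future {n : ℤ} (hn : (e (n + 1) : ℤ) = r - 1 ∨
    (e (n + 1) : ℤ) = r - 2 ∧ 1 - μ < future β e (n + 1)) : 1 - μ < future β e n := by
  have hμ := H.conj_pos
  have hmul := H.mul_conj_eq_one
  have hr := H.add_eq
  have hf0 := H.quasiGreedy.future_nonneg e (n + 1)
  have hf : future β e n = μ * (e (n + 1) + future β e (n + 1)) := by
    rw [← H.quasiGreedy.mul_future h n, ← mul_assoc, mul_comm μ, hmul, one_mul]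
  rw [hf]
  rcases hn with hn | ⟨hn, hlt⟩
  · have hd : (e (n + 1) : ℝ) = r - 1 := by exact_mod_cast hn
    have hsq : 1 - μ + μ * μ = μ * (r - 1) := by linear_combination μ * hr - hmul
    rw [hd]
    nlinarith [mul_nonneg hμ.le hf0, mul_pos hμ hμ]
  · have hd : (e (n + 1) : ℝ) = r - 2 := by exact_mod_cast hn
    have hsq : 1 - μ = μ * (r - 2 + (1 - μ)) := by linear_combination μ * hr - hmul
    rw [hd]
    calc 1 - μ = μ * (r - 2 + (1 - μ)) := hsq
      _ < μ * (r - 2 + future β e (n + 1)) := by gcongr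

/-- A last digit that would push the past below the bound forces, through the admissibility of the
sequence, a large future and hence a better bound one step earlier. -/
lemma sub_past_add_one_le {E : ℝ} {n : ℤ} (hE : -β - past μ e n ≤ E)
    (hE' : 1 - μ < future β e n → 1 - β - past μ e n ≤ E) :
    -β - past μ e (n + 1) ≤ μ * E ∧
      (1 - μ < future β e (n + 1) → 1 - β - past μ e (n + 1) ≤ μ * E) := by
  have hr := H.add_eq
  have hmul := H.mul_conj_eq_one
  have hμ := H.conj_pos
  have hμ1 := (abs_lt.1 H.abs_lt_one).2
  have hq := H.quasiGreedyDigits_zero_of_norm_one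
  have hpast := H.past_add_one h n
  have hle : (e (n + 1) : ℤ) ≤ r - 1 := by
    have := h.le_zero (n + 1)
    omega
  have hweak : μ * (-β - E) ≤ μ * past μ e n := by
    gcongr
    linarith
  have hstrong (hf : 1 - μ < future β e n) : μ * (1 - β - E) ≤ μ * past μ e n := by
    gcongr
    linarith [hE' hf]
  constructor
  · rcases hle.eq_or_lt with heq | hlt
    · have hd : (e (n + 1) : ℝ) = r - 1 := by exact_mod_cast heq
      linarith [hstrong (H.one_sub_conj_lt_future h (Or.inl heq))]
    · have hd : (e (n + 1) : ℝ) ≤ r - 2 := by exact_mod_cast (by omega : (e (n + 1) : ℤ) ≤ r - 2)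
      linarith
  · intro hlt
    have hne : (e (n + 1) : ℤ) ≠ r - 1 := fun heq =>
      hlt.not_ge (H.future_le_of_eq_sub_one h heq)
    rcases (show (e (n + 1) : ℤ) ≤ r - 2 by omega).eq_or_lt with heq | hlt'
    · have hd : (e (n + 1) : ℝ) = r - 2 := by exact_mod_cast heq
      linarith [hstrong (H.one_sub_conj_lt_future h (Or.inr ⟨heq, hlt⟩))]
    · have hd : (e (n + 1) : ℝ) ≤ r - 3 := by exact_mod_cast (by omega : (e (n + 1) : ℤ) ≤ r - 3)
      linarith

lemma le_past_of_norm_one (n : ℤ) :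
    -β ≤ past μ e n ∧ (1 - μ < future β e n → 1 - β ≤ past μ e n) := by
  let S : Set ℝ :=
    {x | ∃ n, x = -β - past μ e n ∨ 1 - μ < future β e n ∧ x = 1 - β - past μ e n}
  have hbdd : BddAbove S := by
    refine ⟨1 - β + quasiGreedyDigits r 1 0 * (1 - |μ|)⁻¹, ?_⟩
    rintro _ ⟨n, rfl | ⟨-, rfl⟩⟩ <;> linarith [(abs_le.1 (abs_past_le H.abs_lt_one h.le_zero n)).1]
  have hS : (0 : ℝ) ∈ upperBounds S := by
    refine zero_mem_upperBounds_of_contracting hbdd (abs_lt.1 H.abs_lt_one).2 fun E hE _ => ?_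
    rintro x ⟨n, hx⟩
    have hstep := H.sub_past_add_one_le h (n := n - 1) (hE ⟨n - 1, Or.inl rfl⟩)
      fun hf => hE ⟨n - 1, Or.inr ⟨hf, rfl⟩⟩
    rw [sub_add_cancel] at hstep
    rcases hx with rfl | ⟨hf, rfl⟩
    exacts [hstep.1, hstep.2 hf]
  exact ⟨by linarith [hS ⟨n, Or.inl rfl⟩], fun hf => by linarith [hS ⟨n, Or.inr ⟨hf, rfl⟩⟩]⟩

lemma mem_rectangles_of_norm_one (n : ℤ) :
    (future β e n, past μ e n) ∈ rectangles β (1 - μ) 0 := by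
  obtain ⟨hlow, hhigh⟩ := H.le_past_of_norm_one h n
  have hf0 := H.quasiGreedy.future_nonneg e n
  have hpast : past μ e n ≤ 0 := by
    have := H.conj_pos
    exact neg_nonpos.2 (tsum_nonneg fun k => by positivity)
  rcases le_or_gt (1 - β) (past μ e n) with hp | hp
  · exact Or.inl ⟨⟨hf0, H.quasiGreedy.future_le_one h n⟩, hp, hpast⟩
  · exact Or.inr ⟨⟨hf0, not_lt.1 fun hf => hp.not_ge (hhigh hf)⟩, hlow, hp.le⟩

end NormOne

section NormNegOne

variable {r : ℤ} (H : IsUnitPair β μ r (-1))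

include H

lemma quasiGreedyDigits_zero_of_norm_neg_one : (quasiGreedyDigits r (-1) 0 : ℤ) = r := by
  rw [quasiGreedyDigits, if_neg (by decide), if_pos Even.zero, Int.toNat_of_nonneg H.trace_pos.le]

variable (h : Admissible (quasiGreedyDigits r (-1)) e)

include h

lemma past_mem_Icc_of_norm_neg_one (n : ℤ) : past μ e n ∈ Set.Icc (-β) 1 := by
  have hr := H.add_eq
  have hmul := H.mul_conj_eq_neg_one
  have hμ := H.conj_neg
  have hq := H.quasiGreedyDigits_zero_of_norm_neg_one
  let S : Set ℝ := {x | ∃ n, x = -β - past μ e n ∨ x = past μ e n - 1}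
  have hbdd : BddAbove S := by
    refine ⟨quasiGreedyDigits r (-1) 0 * (1 - |μ|)⁻¹, ?_⟩
    rintro _ ⟨n, rfl | rfl⟩ <;>
      linarith [abs_le.1 (abs_past_le H.abs_lt_one h.le_zero n), H.one_lt]
  have hS : (0 : ℝ) ∈ upperBounds S := by
    refine zero_mem_upperBounds_of_contracting (ρ := -μ) hbdd
      (by linarith [(abs_lt.1 H.abs_lt_one).1]) fun E hE _ x hx => ?_
    obtain ⟨m, hx⟩ := hx
    obtain ⟨n, rfl⟩ : ∃ n, m = n + 1 := ⟨m - 1, by ring⟩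
    have hle : (e (n + 1) : ℝ) ≤ r := by
      have := h.le_zero (n + 1)
      exact_mod_cast (by omega : (e (n + 1) : ℤ) ≤ r)
    have hpast := H.past_add_one h n
    rcases hx with rfl | rfl
    · have : μ * (1 + E) ≤ μ * past μ e n :=
        mul_le_mul_of_nonpos_left (by linarith [hE ⟨n, Or.inr rfl⟩]) hμ.le
      linarith
    · have : μ * past μ e n ≤ μ * (-β - E) :=
        mul_le_mul_of_nonpos_left (by linarith [hE ⟨n, Or.inl rfl⟩]) hμ.le
      linarith [(e (n + 1)).cast_nonneg (α := ℝ)]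
  exact ⟨by linarith [hS ⟨n, Or.inl rfl⟩], by linarith [hS ⟨n, Or.inr rfl⟩]⟩

lemma mem_rectangles_of_norm_neg_one (n : ℤ) :
    (future β e n, past μ e n) ∈ rectangles β (-μ) 1 := by
  have hq := H.quasiGreedyDigits_zero_of_norm_neg_one
  have hr := H.add_eq
  have hf0 := H.quasiGreedy.future_nonneg e n
  obtain ⟨hlow, hhigh⟩ := H.past_mem_Icc_of_norm_neg_one h n
  rcases le_or_gt (1 - β) (past μ e n) with hp | hp
  · exact Or.inl ⟨⟨hf0, H.quasiGreedy.future_le_one h n⟩, hp, hhigh⟩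
  · refine Or.inr ⟨⟨hf0, ?_⟩, hlow, hp.le⟩
    have hdigit : (e n : ℤ) = r := by
      by_contra hne
      have hle : (e n : ℝ) ≤ r - 1 := by
        have := h.le_zero n
        exact_mod_cast (by omega : (e n : ℤ) ≤ r - 1)
      have hpast := H.past_add_one h (n - 1)
      rw [sub_add_cancel] at hpast
      have : μ * 1 ≤ μ * past μ e (n - 1) :=
        mul_le_mul_of_nonpos_left (H.past_mem_Icc_of_norm_neg_one h (n - 1)).2 H.conj_neg.le
      linarith
    have hq' : (quasiGreedyDigits r (-1) 0 : ℝ) = r := by exact_mod_cast hq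
    refine (H.quasiGreedy.future_le_of_eq h (n := n) (by omega)).trans_eq ?_
    rw [hq', ← hr]
    ring

end NormNegOne

/-- The two rectangles have total area `β - μ`, the covolume of `conjLattice β μ`. -/
theorem exists_rectangles {r σ : ℤ} (H : IsUnitPair β μ r σ) :
    ∃ κ s : ℝ, 0 ≤ κ ∧ 1 - β ≤ s ∧ κ + s = 1 - μ ∧
      ∀ e : ℤ → ℕ, Admissible (quasiGreedyDigits r σ) e → ∀ n,
        (future β e n, past μ e n) ∈ rectangles β κ s := by
  have hβ := H.one_lt
  have hμ := abs_lt.1 H.abs_lt_one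
  rcases Int.isUnit_iff.1 H.isUnit_norm with rfl | rfl
  · exact ⟨1 - μ, 0, by linarith, by linarith, by ring, fun _ h => H.mem_rectangles_of_norm_one h⟩
  · exact ⟨-μ, 1, by linarith [H.conj_neg], by linarith, by ring,
      fun _ h => H.mem_rectangles_of_norm_neg_one h⟩

end IsUnitPair

/-! ### Every point of the plane is represented -/

section Topology

variable {β μ : ℝ}

lemma isClosed_setOf_toLex_le (q : ℕ → ℕ) : IsClosed {a : ℕ → ℕ | toLex a ≤ toLex q} := by
  have hcompl : {a : ℕ → ℕ | toLex a ≤ toLex q}ᶜ =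
      ⋃ j : ℕ, (⋂ i ∈ Finset.range j, {a | q i = a i}) ∩ {a | q j < a j} := by
    ext a
    simp only [Set.mem_compl_iff, Set.mem_ofPred_eq, not_le, Set.mem_iUnion, Set.mem_inter_iff,
      Set.mem_iInter, Finset.mem_range]
    rfl
  rw [← isOpen_compl_iff, hcompl]
  exact isOpen_iUnion fun j => (isOpen_biInter_finset fun i _ =>
    (isOpen_discrete {x : ℕ | q i = x}).preimage (continuous_apply i)).inter
    ((isOpen_discrete (Set.Ioi (q j))).preimage (continuous_apply j))

lemma continuous_tail (n : ℤ) : Continuous fun e : ℤ → ℕ => tail e n :=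
  continuous_pi fun i => continuous_apply (n + (i : ℤ))

lemma isCompact_setOf_admissible (q : ℕ → ℕ) : IsCompact {e : ℤ → ℕ | Admissible q e} := by
  have hclosed : IsClosed {e : ℤ → ℕ | Admissible q e} := by
    simp only [Admissible, Set.ofPred_forall]
    exact isClosed_iInter fun n => (isClosed_setOf_toLex_le q).preimage (continuous_tail n)
  exact (isCompact_univ_pi (X := fun _ : ℤ => ℕ) (s := fun _ => Set.Iic (q 0)) fun _ =>
    (Set.finite_Iic _).isCompact).of_isClosed_subset hclosed fun e he n _ => he.le_zero n

lemma continuous_digit (n : ℤ) : Continuous fun e : ℤ → ℕ => (e n : ℝ) :=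
  continuous_of_discreteTopology.comp (continuous_apply n)

lemma continuousOn_future (hβ : 1 < β) (q : ℕ → ℕ) (n : ℤ) :
    ContinuousOn (fun e : ℤ → ℕ => future β e n) {e | Admissible q e} := by
  refine continuousOn_tsum (u := fun k => (q 0 : ℝ) * (β ^ (k + 1))⁻¹)
    (fun k => ((continuous_digit _).mul continuous_const).continuousOn)
    ((hasSum_inv_pow_succ hβ).summable.mul_left _) fun k e he => ?_
  rw [Real.norm_of_nonneg (by positivity)]
  gcongr
  exact he.le_zero _

lemma continuousOn_past (hμ : |μ| < 1) (q : ℕ → ℕ) (n : ℤ) :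
    ContinuousOn (fun e : ℤ → ℕ => past μ e n) {e | Admissible q e} :=
  (continuousOn_tsum (fun _ => ((continuous_digit _).mul continuous_const).continuousOn)
    ((summable_geometric_of_lt_one (abs_nonneg μ) hμ).mul_left (q 0 : ℝ))
    fun k _ he => norm_past_term_le he.le_zero n k).neg

end Topology

/-- The two-sided sequence with future `a` at time `0` and trivial past. -/
def ofFuture (a : ℕ → ℕ) (n : ℤ) : ℕ := if n ≤ 0 then 0 else a (n - 1).toNat

section OfFuture

variable {a : ℕ → ℕ}

lemma ofFuture_of_nonpos {n : ℤ} (hn : n ≤ 0) : ofFuture a n = 0 := if_pos hn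

lemma tail_ofFuture (a : ℕ → ℕ) (n : ℕ) : tail (ofFuture a) (n + 1) = tail a n := by
  funext i
  have hpos : ¬(n + 1 + i : ℤ) ≤ 0 := by omega
  have hsub : (n + 1 + i - 1 : ℤ).toNat = n + i := by omega
  simp only [tail_apply, ofFuture, if_neg hpos, hsub, Nat.cast_id]

lemma future_ofFuture (β : ℝ) : future β (ofFuture a) 0 = value β a := by
  have := tail_ofFuture a 0
  rw [Nat.cast_zero, tail_zero] at this
  rw [future, this]

lemma past_ofFuture (μ : ℝ) : past μ (ofFuture a) 0 = 0 := by
  have hterm (k : ℕ) : ofFuture a (0 - k) = 0 := ofFuture_of_nonpos (by omega)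
  simp only [past, hterm, Nat.cast_zero, zero_mul, tsum_zero, neg_zero]

lemma Admissible.ofFuture {q : ℕ → ℕ} (hq : 0 < q 0) (h : Admissible q a) :
    Admissible q (ofFuture a) := by
  intro n
  rcases le_or_gt n 0 with hn | hn
  · refine le_of_lt ⟨0, fun i hi => absurd hi i.not_lt_zero, ?_⟩
    rw [Pi.toLex_apply, tail_apply, Nat.cast_zero, add_zero, ofFuture_of_nonpos hn]
    exact hq
  · obtain ⟨m, rfl⟩ : ∃ m : ℕ, n = m + 1 := ⟨(n - 1).toNat, by omega⟩
    rw [tail_ofFuture]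
    exact h m

end OfFuture

/-- The set of points that agree modulo `conjLattice β μ` with the pair (future, past) of an
admissible sequence. -/
def representedPoints (β μ : ℝ) (q : ℕ → ℕ) : Set (ℝ × ℝ) :=
  (fun e => (future β e 0, past μ e 0)) '' {e | Admissible q e} + (conjLattice β μ : Set (ℝ × ℝ))

lemma mem_representedPoints {β μ : ℝ} {q : ℕ → ℕ} {p : ℝ × ℝ} :
    p ∈ representedPoints β μ q ↔
      ∃ e, Admissible q e ∧ p - (future β e 0, past μ e 0) ∈ conjLattice β μ := by
  constructor
  · rintro ⟨_, ⟨e, he, rfl⟩, w, hw, rfl⟩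
    exact ⟨e, he, by simpa using hw⟩
  · rintro ⟨e, he, h⟩
    exact ⟨_, ⟨e, he, rfl⟩, _, h, add_sub_cancel _ _⟩

lemma add_mem_representedPoints {β μ : ℝ} {q : ℕ → ℕ} {p w : ℝ × ℝ}
    (hp : p ∈ representedPoints β μ q) (hw : w ∈ conjLattice β μ) :
    p + w ∈ representedPoints β μ q := by
  obtain ⟨e, he, h⟩ := mem_representedPoints.1 hp
  refine mem_representedPoints.2 ⟨e, he, ?_⟩
  rw [add_sub_right_comm]
  exact add_mem h hw

namespace IsUnitPair

variable {β μ : ℝ} {r σ : ℤ} (H : IsUnitPair β μ r σ)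

include H

lemma isClosed_representedPoints : IsClosed (representedPoints β μ (quasiGreedyDigits r σ)) :=
  H.isClosed_conjLattice.add_left_of_isCompact <|
    (isCompact_setOf_admissible _).image_of_continuousOn
      ((continuousOn_future H.one_lt _ 0).prodMk (continuousOn_past H.abs_lt_one _ 0))

lemma mem_representedPoints_of_mem_Ico {x : ℝ} (hx : x ∈ Set.Ico (0 : ℝ) 1) :
    (x, 0) ∈ representedPoints β μ (quasiGreedyDigits r σ) := by
  obtain ⟨a, ha, ha1, rfl⟩ := exists_greedy_expansion H.one_lt hx
  have hadm : Admissible (quasiGreedyDigits r σ) a := fun k =>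
    (H.quasiGreedy.toLex_lt_of_value_lt_one (ha.tail H.pos.ne' k) (ha1 k)).le
  refine mem_representedPoints.2 ⟨ofFuture a, hadm.ofFuture H.quasiGreedy.one_le_zero, ?_⟩
  rw [future_ofFuture, past_ofFuture, sub_self]
  exact zero_mem _

lemma mul_mem_representedPoints {u v : ℝ}
    (h : (u, v) ∈ representedPoints β μ (quasiGreedyDigits r σ)) :
    (β * u, μ * v) ∈ representedPoints β μ (quasiGreedyDigits r σ) := by
  obtain ⟨e, he, hmem⟩ := mem_representedPoints.1 h
  refine mem_representedPoints.2 ⟨fun n => e (n + 1), he.comp_add 1, ?_⟩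
  have hfuture := H.quasiGreedy.mul_future he 0
  have hpast := H.past_add_one he 0
  rw [zero_add] at hfuture hpast
  rw [future_comp_add, past_comp_add, zero_add]
  convert! add_mem (H.mul_mem_conjLattice hmem) (intCast_mem_conjLattice β μ (e 1)) using 1
  ext
  · simp only [Prod.fst_add, Prod.fst_sub, Int.cast_natCast]
    linarith
  · simp only [Prod.snd_add, Prod.snd_sub, Int.cast_natCast]
    linarith

lemma mem_representedPoints_of_nonneg {x : ℝ} (hx : 0 ≤ x) :
    (x, 0) ∈ representedPoints β μ (quasiGreedyDigits r σ) := by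
  obtain ⟨n, hn⟩ := pow_unbounded_of_one_lt x H.one_lt
  have hpos : 0 < β ^ n := pow_pos H.pos n
  have hpow (m : ℕ) :
      (β ^ m * (x / β ^ n), 0) ∈ representedPoints β μ (quasiGreedyDigits r σ) := by
    induction m with
    | zero =>
      rw [pow_zero, one_mul]
      exact H.mem_representedPoints_of_mem_Ico ⟨by positivity, (div_lt_one hpos).2 hn⟩
    | succ m ih => simpa only [pow_succ', mul_assoc, mul_zero] using H.mul_mem_representedPoints ih
  simpa only [mul_div_cancel₀ x hpos.ne'] using hpow n

/-- The lattice vectors `(β²ⁿ (1 - β), μ²ⁿ (1 - μ))` have arbitrarily small positive second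
coordinate and negative first coordinate. -/
lemma exists_mem_conjLattice_le_abs_sub_lt (u v : ℝ) {δ : ℝ} (hδ : 0 < δ) :
    ∃ w ∈ conjLattice β μ, w.1 ≤ u ∧ |v - w.2| < δ := by
  have hβ := H.one_lt
  have hμ := abs_lt.1 H.abs_lt_one
  have hμ0 := H.ne_zero
  have hlim : Tendsto (fun n : ℕ => (μ ^ 2) ^ n * (1 - μ)) atTop (𝓝 0) := by
    have : μ ^ 2 < 1 := by nlinarith
    simpa using (tendsto_pow_atTop_nhds_zero_of_lt_one (by positivity) this).mul_const (1 - μ)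
  obtain ⟨n, hn⟩ := (hlim.eventually (gt_mem_nhds hδ)).exists
  let p := ((β ^ 2) ^ n * (1 - β), (μ ^ 2) ^ n * (1 - μ))
  have hp₂ : 0 < p.2 := mul_pos (by positivity) (by linarith)
  have hp₁ : p.1 ≤ 0 := mul_nonpos_of_nonneg_of_nonpos (by positivity) (by linarith)
  have hp : p ∈ conjLattice β μ := by
    simp only [p, ← pow_mul]
    exact H.pow_mul_mem_conjLattice ⟨1, -1, by push_cast; ring, by push_cast; ring⟩ _
  obtain ⟨m, hm⟩ := exists_nat_ge (max |u| |v|)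
  have hu := (abs_le.1 ((le_max_left _ _).trans hm)).1
  have hv := (abs_le.1 ((le_max_right _ _).trans hm)).1
  set j := ⌊(v + m) / p.2⌋
  have hj0 : (0 : ℝ) ≤ j := by
    exact_mod_cast Int.floor_nonneg.2 (div_nonneg (by linarith : 0 ≤ v + m) hp₂.le)
  have hj₁ : (j : ℝ) * p.2 ≤ v + m := (le_div_iff₀ hp₂).1 (Int.floor_le _)
  have hj₂ : v + m < (j + 1) * p.2 := (div_lt_iff₀ hp₂).1 (Int.lt_floor_add_one _)
  refine ⟨j • p - (((m : ℤ) : ℝ), ((m : ℤ) : ℝ)),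
    sub_mem (zsmul_mem hp j) (intCast_mem_conjLattice β μ m), ?_⟩
  simp only [Prod.fst_sub, Prod.snd_sub, zsmul_eq_mul, Prod.fst_mul, Prod.snd_mul,
    Prod.fst_intCast, Prod.snd_intCast, Int.cast_natCast]
  have := mul_nonpos_of_nonneg_of_nonpos hj0 hp₁
  exact ⟨by linarith, abs_lt.2 ⟨by linarith [show p.2 < δ from hn], by linarith⟩⟩

theorem representedPoints_eq_univ :
    representedPoints β μ (quasiGreedyDigits r σ) = Set.univ := by
  refine Set.eq_univ_of_forall fun ⟨u, v⟩ =>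
    H.isClosed_representedPoints.closure_subset (Metric.mem_closure_iff.2 fun δ hδ => ?_)
  obtain ⟨w, hw, hw₁, hw₂⟩ := H.exists_mem_conjLattice_le_abs_sub_lt u v hδ
  refine ⟨(u, w.2), ?_, max_lt (by rwa [dist_self]) hw₂⟩
  have h := add_mem_representedPoints
    (H.mem_representedPoints_of_nonneg (sub_nonneg.2 hw₁)) hw
  rwa [Prod.mk_add_mk, sub_add_cancel, zero_add] at h

end IsUnitPair

/-! ### The symbolic space -/

section Dominated

variable {ι X : Type*} [TopologicalSpace X] {f g : ι → X → ℝ}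

lemma lowerSemicontinuous_tsum_of_nonneg (hf : ∀ k, Continuous (f k)) (hf0 : ∀ k x, 0 ≤ f k x)
    (hsum : ∀ x, Summable fun k => f k x) : LowerSemicontinuous fun x => ∑' k, f k x := by
  intro x y hy
  obtain ⟨s, hs⟩ := ((hsum x).hasSum.eventually (lt_mem_nhds hy)).exists
  filter_upwards [((continuous_finsetSum s fun k _ => hf k).tendsto x).eventually
    (lt_mem_nhds hs)] with x' hx'
  exact hx'.trans_le ((hsum x').sum_le_tsum s fun k _ => hf0 k x')

lemma lowerSemicontinuous_tsum_of_dominated (hf : ∀ k, Continuous (f k))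
    (hg : ∀ k, Continuous (g k)) (hfg : ∀ k x, |f k x| ≤ g k x)
    (hsum : ∀ x, Summable fun k => g k x) (hcont : Continuous fun x => ∑' k, g k x) :
    LowerSemicontinuous fun x => ∑' k, f k x := by
  have hsumf (x : X) : Summable fun k => f k x := .of_norm_bounded (hsum x) fun k => hfg k x
  have hlower := (lowerSemicontinuous_tsum_of_nonneg (f := fun k x => f k x + g k x)
    (fun k => (hf k).add (hg k))
    (fun k x => by linarith [(abs_le.1 (hfg k x)).1])
    fun x => (hsumf x).add (hsum x)).add hcont.neg.lowerSemicontinuous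
  simpa only [fun x => (hsumf x).tsum_add (hsum x), Pi.neg_apply, add_neg_cancel_right]
    using hlower

/-- Both `∑' (g + f)` and `∑' (g - f)` are lower semicontinuous, being sums of nonnegative
functions; as `∑' g` is continuous, `∑' f` is both lower and upper semicontinuous. -/
lemma continuous_tsum_of_dominated (hf : ∀ k, Continuous (f k)) (hg : ∀ k, Continuous (g k))
    (hfg : ∀ k x, |f k x| ≤ g k x) (hsum : ∀ x, Summable fun k => g k x)
    (hcont : Continuous fun x => ∑' k, g k x) : Continuous fun x => ∑' k, f k x := by
  refine continuous_iff_lower_upperSemicontinuous.2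
    ⟨lowerSemicontinuous_tsum_of_dominated hf hg hfg hsum hcont, ?_⟩
  have hneg := lowerSemicontinuous_tsum_of_dominated (f := fun k x => -f k x)
    (fun k => (hf k).neg) hg (fun k x => (abs_neg _).trans_le (hfg k x)) hsum hcont
  simp only [tsum_neg] at hneg
  intro x y hy
  filter_upwards [hneg x (-y) (neg_lt_neg hy)] with x' hx' using neg_lt_neg_iff.1 hx'

end Dominated

lemma tendsto_tsum_ite_lt {f : ℕ → ℝ} (hf : Summable f) :
    Tendsto (fun m => ∑' k, if k < m then f k else 0) atTop (𝓝 (∑' k, f k)) := by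
  refine hf.hasSum.tendsto_sum_nat.congr fun m => ?_
  rw [tsum_eq_sum (s := Finset.range m) fun k hk => if_neg (mt Finset.mem_range.2 hk)]
  exact Finset.sum_congr rfl fun k hk => (if_pos (Finset.mem_range.1 hk)).symm

lemma value_add {β : ℝ} {a b : ℕ → ℕ} (ha : SummableValue β a) (hb : SummableValue β b) :
    value β (a + b) = value β a + value β b := by
  simp only [value, ← ha.tsum_add hb, Pi.add_apply, Nat.cast_add, add_mul]

namespace SymbolicSpace

variable {β : ℝ}

lemma ext {ε ε' : SymbolicSpace β} (h : ∀ n, ε.digit n = ε'.digit n) : ε = ε' :=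
  Subtype.ext (funext h)

lemma digit_add (ε ε' : SymbolicSpace β) : (ε + ε').digit = ε.digit + ε'.digit := rfl

lemma digit_zero (n : ℤ) : (0 : SymbolicSpace β).digit n = 0 := rfl

lemma digit_shift (ε : SymbolicSpace β) (n : ℤ) : ε.shift.digit n = ε.digit (n + 1) := rfl

/-- The homomorphism reading off the `n`-th digit. -/
def digitHom (n : ℤ) : SymbolicSpace β →+ ℕ where
  toFun ε := ε.digit n
  map_zero' := rfl
  map_add' _ _ := rfl

lemma tail_digit_one (ε : SymbolicSpace β) : tail ε.digit 1 = fun k : ℕ => ε.digit (k + 1) :=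
  funext fun k => congrArg ε.digit (add_comm 1 (k : ℤ))

lemma summableValue_right (ε : SymbolicSpace β) : SummableValue β (tail ε.digit 1) := by
  rw [tail_digit_one]
  exact ε.2.1

lemma summableValue_left (ε : SymbolicSpace β) :
    SummableValue β fun k : ℕ => ε.digit (-(k + 1)) := ε.2.2

lemma rightSum_eq_future (ε : SymbolicSpace β) : ε.rightSum = future β ε.digit 0 := by
  rw [future, zero_add, tail_digit_one]
  rfl

lemma tendsto_nhds_iff {ι : Type*} {l : Filter ι} {f : ι → SymbolicSpace β}
    {ε : SymbolicSpace β} :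
    Tendsto f l (𝓝 ε) ↔ (∀ n, ∀ᶠ i in l, (f i).digit n = ε.digit n) ∧
      Tendsto (fun i => (f i).rightSum) l (𝓝 ε.rightSum) ∧
      Tendsto (fun i => (f i).leftSum) l (𝓝 ε.leftSum) := by
  rw [nhds_induced, tendsto_comap_iff, nhds_prod_eq, nhds_prod_eq, tendsto_prod_iff',
    tendsto_prod_iff', tendsto_pi_nhds]
  simp only [Function.comp_def, nhds_discrete, tendsto_pure]

lemma continuous_data :
    Continuous fun ε : SymbolicSpace β => (ε.digit, ε.rightSum, ε.leftSum) :=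
  continuous_induced_dom

lemma continuous_digit (n : ℤ) : Continuous fun ε : SymbolicSpace β => ε.digit n :=
  (continuous_apply n).comp (continuous_fst.comp continuous_data)

lemma continuous_rightSum : Continuous fun ε : SymbolicSpace β => ε.rightSum :=
  (continuous_fst.comp continuous_snd).comp continuous_data

lemma continuous_leftSum : Continuous fun ε : SymbolicSpace β => ε.leftSum :=
  (continuous_snd.comp continuous_snd).comp continuous_data

lemma continuous_natCast_digit (n : ℤ) :
    Continuous fun ε : SymbolicSpace β => (ε.digit n : ℝ) :=
  continuous_of_discreteTopology.comp (continuous_digit n)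

lemma continuous_tsum_left {c : ℕ → ℝ} (hc : ∀ k, |c k| ≤ (β ^ (k + 1))⁻¹) :
    Continuous fun ε : SymbolicSpace β => ∑' k : ℕ, (ε.digit (-((k : ℤ) + 1)) : ℝ) * c k := by
  refine continuous_tsum_of_dominated
    (fun _ => (continuous_natCast_digit _).mul continuous_const)
    (fun _ => (continuous_natCast_digit _).mul continuous_const)
    (fun k ε => ?_) summableValue_left continuous_leftSum
  rw [abs_mul, Nat.abs_cast]
  exact mul_le_mul_of_nonneg_left (hc k) (Nat.cast_nonneg _)

lemma summableValue_of_finite {e : ℤ → ℕ} (h : {n | e n ≠ 0}.Finite) {p : ℕ → ℤ}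
    (hp : p.Injective) : SummableValue β fun k => e (p k) :=
  summable_of_hasFiniteSupport <| (h.preimage hp.injOn).subset fun _ hk h0 =>
    hk (by simp only [h0, Nat.cast_zero, zero_mul])

/-- The element of the symbolic space given by a sequence with finitely many nonzero digits. -/
def ofFinite (β : ℝ) (e : ℤ → ℕ) (h : {n | e n ≠ 0}.Finite) : SymbolicSpace β :=
  ⟨e, summableValue_of_finite h (p := fun k => (k : ℤ) + 1) fun _ _ hab => by simpa using hab,
    summableValue_of_finite h (p := fun k => -((k : ℤ) + 1)) fun _ _ hab => by simpa using hab⟩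

lemma isFinite_ofFinite {e : ℤ → ℕ} (h : {n | e n ≠ 0}.Finite) : (ofFinite β e h).IsFinite := h

lemma digit_ofFinite {e : ℤ → ℕ} (h : {n | e n ≠ 0}.Finite) : (ofFinite β e h).digit = e := rfl

/-- The sequence with a single nonzero digit, equal to one, at the `n`-th place. -/
def single (β : ℝ) (n : ℤ) : SymbolicSpace β :=
  ofFinite β (Pi.single n 1) ((Set.finite_singleton n).subset fun m hm => by
    by_contra hne
    exact hm (Pi.single_eq_of_ne hne _))

lemma digit_single (n m : ℤ) : (single β n).digit m = if m = n then 1 else 0 := by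
  rw [single, digit_ofFinite, Pi.single_apply]

lemma shift_single (n : ℤ) : (single β n).shift = single β (n - 1) := by
  refine ext fun m => ?_
  rw [digit_shift, digit_single, digit_single]
  simp only [eq_sub_iff_add_eq]

/-- The truncation of a sequence to the places in `[-m, m]`. -/
def trunc (m : ℕ) (ε : SymbolicSpace β) : SymbolicSpace β :=
  ofFinite β (fun n => if |n| ≤ m then ε.digit n else 0)
    ((Set.finite_Icc (-(m : ℤ)) m).subset fun n hn => by
      by_contra hc
      exact hn (if_neg fun h => hc (abs_le.1 h)))

lemma digit_trunc (m : ℕ) (ε : SymbolicSpace β) (n : ℤ) :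
    (ε.trunc m).digit n = if |n| ≤ m then ε.digit n else 0 := rfl

lemma trunc_eq_sum (m : ℕ) (ε : SymbolicSpace β) :
    ε.trunc m = ∑ n ∈ Finset.Icc (-(m : ℤ)) m, ε.digit n • single β n := by
  refine ext fun k => ?_
  have hsum : (∑ n ∈ Finset.Icc (-(m : ℤ)) m, ε.digit n • single β n).digit k =
      ∑ n ∈ Finset.Icc (-(m : ℤ)) m, ε.digit n • (single β n).digit k := by
    change digitHom k _ = _
    rw [map_sum]
    exact Finset.sum_congr rfl fun n _ => map_nsmul _ _ _
  rw [hsum, digit_trunc]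
  simp [digit_single, abs_le]

lemma tendsto_trunc (ε : SymbolicSpace β) : Tendsto (fun m => ε.trunc m) atTop (𝓝 ε) := by
  have hpos (m k : ℕ) : |(k : ℤ) + 1| ≤ m ↔ k < m := by
    rw [abs_le]
    omega
  refine tendsto_nhds_iff.2 ⟨fun n => ?_, ?_, ?_⟩
  · filter_upwards [eventually_ge_atTop n.natAbs] with m hm
    rw [digit_trunc, if_pos (abs_le.2 (by omega))]
  · refine (tendsto_tsum_ite_lt ε.2.1).congr fun m => tsum_congr fun k => ?_
    simp only [digit_trunc, hpos, Nat.cast_ite, Nat.cast_zero, ite_mul, zero_mul]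
    rfl
  · refine (tendsto_tsum_ite_lt ε.2.2).congr fun m => tsum_congr fun k => ?_
    simp only [digit_trunc, abs_neg, hpos, Nat.cast_ite, Nat.cast_zero, ite_mul, zero_mul]
    rfl

lemma tsum_eq_of_digit_eq_ite {ε : SymbolicSpace β} {p : ℕ → ℤ} {k : ℕ}
    (h : ∀ i, ε.digit (p i) = if i = k then 1 else 0) :
    ∑' i : ℕ, (ε.digit (p i) : ℝ) * (β ^ (i + 1))⁻¹ = (β ^ (k + 1))⁻¹ := by
  simp [h]

lemma rightSum_single_add_one (k : ℕ) : (single β (k + 1)).rightSum = (β ^ (k + 1))⁻¹ :=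
  tsum_eq_of_digit_eq_ite fun i => by simp [digit_single]

lemma rightSum_single_of_nonpos {n : ℤ} (hn : n ≤ 0) : (single β n).rightSum = 0 := by
  have h0 (i : ℕ) : (single β n).digit (i + 1) = 0 := by rw [digit_single, if_neg (by omega)]
  simp only [rightSum, h0, Nat.cast_zero, zero_mul, tsum_zero]

lemma leftSum_single_neg (k : ℕ) : (single β (-(k + 1))).leftSum = (β ^ (k + 1))⁻¹ :=
  tsum_eq_of_digit_eq_ite fun i => by simp [digit_single]

lemma leftSum_single_of_nonneg {n : ℤ} (hn : 0 ≤ n) : (single β n).leftSum = 0 := by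
  have h0 (i : ℕ) : (single β n).digit (-(i + 1)) = 0 := by rw [digit_single, if_neg (by omega)]
  simp only [leftSum, h0, Nat.cast_zero, zero_mul, tsum_zero]

lemma rightSum_zero : (0 : SymbolicSpace β).rightSum = 0 := by
  simp only [rightSum, digit_zero, Nat.cast_zero, zero_mul, tsum_zero]

lemma leftSum_zero : (0 : SymbolicSpace β).leftSum = 0 := by
  simp only [leftSum, digit_zero, Nat.cast_zero, zero_mul, tsum_zero]

lemma tendsto_inv_pow_succ (hβ : 1 < β) : Tendsto (fun k : ℕ => (β ^ (k + 1))⁻¹) atTop (𝓝 0) :=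
  (hasSum_inv_pow_succ hβ).summable.tendsto_atTop_zero

lemma tendsto_single_atTop (hβ : 1 < β) :
    Tendsto (fun n : ℕ => single β (n : ℤ)) atTop (𝓝 0) := by
  refine (tendsto_add_atTop_iff_nat 1).1 (tendsto_nhds_iff.2 ⟨fun n => ?_, ?_, ?_⟩)
  · filter_upwards [eventually_gt_atTop n.natAbs] with m hm
    rw [digit_single, if_neg (by omega), digit_zero]
  · simpa only [Nat.cast_add_one, rightSum_single_add_one, rightSum_zero] using
      tendsto_inv_pow_succ hβ
  · simp only [leftSum_single_of_nonneg (Int.natCast_nonneg _), leftSum_zero, tendsto_const_nhds]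

lemma tendsto_single_neg_atTop (hβ : 1 < β) :
    Tendsto (fun n : ℕ => single β (-(n : ℤ))) atTop (𝓝 0) := by
  refine (tendsto_add_atTop_iff_nat 1).1 (tendsto_nhds_iff.2 ⟨fun n => ?_, ?_, ?_⟩)
  · filter_upwards [eventually_gt_atTop n.natAbs] with m hm
    rw [digit_single, if_neg (by omega), digit_zero]
  · simp only [rightSum_single_of_nonpos (neg_nonpos.2 (Int.natCast_nonneg _)), rightSum_zero,
      tendsto_const_nhds]
  · simpa only [Nat.cast_add_one, leftSum_single_neg, leftSum_zero] using tendsto_inv_pow_succ hβ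

/-- The element of the symbolic space given by a sequence with bounded digits. -/
def ofBounded (hβ : 1 < β) (e : ℤ → ℕ) {R : ℕ} (h : ∀ n, e n ≤ R) : SymbolicSpace β :=
  ⟨e, summableValue_of_le hβ (a := fun k : ℕ => e ((k : ℤ) + 1)) fun _ => h _,
    summableValue_of_le hβ (a := fun k : ℕ => e (-((k : ℤ) + 1))) fun _ => h _⟩

lemma digit_ofBounded (hβ : 1 < β) {e : ℤ → ℕ} {R : ℕ} (h : ∀ n, e n ≤ R) :
    (ofBounded hβ e h).digit = e := rfl

lemma hom_ext {A : Type*} [AddCommMonoid A] [TopologicalSpace A] [T2Space A]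
    {φ ψ : SymbolicSpace β →+ A} (hφ : Continuous φ) (hψ : Continuous ψ)
    (h : ∀ n, φ (single β n) = ψ (single β n)) : φ = ψ := by
  ext ε
  have hlimφ := (hφ.tendsto ε).comp ε.tendsto_trunc
  have hlimψ := (hψ.tendsto ε).comp ε.tendsto_trunc
  refine tendsto_nhds_unique hlimφ (hlimψ.congr fun m => ?_)
  simp only [Function.comp_def, trunc_eq_sum, map_sum, map_nsmul, h]

end SymbolicSpace

namespace IsUnitPair

variable {β μ : ℝ} {r σ : ℤ} (H : IsUnitPair β μ r σ)

include H

lemma abs_pow_eq (k : ℕ) : |μ ^ k| = (β ^ k)⁻¹ := by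
  rw [abs_pow, H.abs_eq, inv_pow]

lemma summable_past (ε : SymbolicSpace β) :
    Summable fun k : ℕ => (ε.digit (0 - k) : ℝ) * μ ^ k := by
  refine (summable_nat_add_iff 1).1 (.of_norm_bounded ε.summableValue_left fun k => ?_)
  rw [norm_mul, Real.norm_natCast, Real.norm_eq_abs, H.abs_pow_eq, zero_sub, Nat.cast_add_one]

lemma past_eq_neg_sub_tsum (ε : SymbolicSpace β) : past μ ε.digit 0 =
    -(ε.digit 0 : ℝ) - ∑' k : ℕ, (ε.digit (-((k : ℤ) + 1)) : ℝ) * μ ^ (k + 1) := by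
  rw [past, (H.summable_past ε).tsum_eq_zero_add, neg_add']
  simp only [Nat.cast_zero, sub_zero, pow_zero, mul_one, zero_sub, Nat.cast_add_one]

/-- The homomorphism mapping a sequence to the values of its future and of its past. -/
def codingPair : SymbolicSpace β →+ ℝ × ℝ where
  toFun ε := (future β ε.digit 0, past μ ε.digit 0)
  map_zero' := by simp [future, past, value, tail, digit_zero]
  map_add' ε ε' := by
    have htail : tail (ε + ε').digit 1 = tail ε.digit 1 + tail ε'.digit 1 := rfl
    ext
    · simp only [future, zero_add, htail, value_add ε.summableValue_right ε'.summableValue_right,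
        Prod.mk_add_mk]
    · simp only [past, digit_add, Pi.add_apply, Nat.cast_add, add_mul, Prod.mk_add_mk,
        (H.summable_past ε).tsum_add (H.summable_past ε'), neg_add]

lemma codingPair_apply (ε : SymbolicSpace β) :
    H.codingPair ε = (future β ε.digit 0, past μ ε.digit 0) := rfl

lemma continuous_codingPair : Continuous H.codingPair := by
  refine Continuous.prodMk ?_ ?_
  · simp only [← rightSum_eq_future]
    exact continuous_rightSum
  · simp only [H.past_eq_neg_sub_tsum]
    exact (continuous_natCast_digit 0).neg.sub
      (continuous_tsum_left fun k => (H.abs_pow_eq (k + 1)).le)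

lemma codingPair_shift (ε : SymbolicSpace β) :
    H.codingPair ε.shift =
      (β * (H.codingPair ε).1 - ε.digit 1, μ * (H.codingPair ε).2 - ε.digit 1) := by
  have hshift : ε.shift.digit = fun n => ε.digit (n + 1) := rfl
  have hfuture := ToralCoding.mul_future H.pos.ne' (n := 0) ε.summableValue_right
  have hpast := ToralCoding.past_add_one (H.summable_past ε)
  rw [codingPair_apply, codingPair_apply, hshift, future_comp_add, past_comp_add, hpast, hfuture,
    zero_add, add_sub_cancel_left]

lemma codingPair_single_zero : H.codingPair (single β 0) = (0, -1) := by
  have hpast (k : ℕ) : (single β 0).digit (-((k : ℤ) + 1)) = 0 := by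
    rw [digit_single, if_neg (by omega)]
  have hzero : (single β 0).digit 0 = 1 := digit_single 0 0
  rw [codingPair_apply, ← rightSum_eq_future, rightSum_single_of_nonpos le_rfl,
    H.past_eq_neg_sub_tsum, hzero]
  simp only [hpast, Nat.cast_zero, Nat.cast_one, zero_mul, tsum_zero, sub_zero]

end IsUnitPair

/-! ### The torus and its homoclinic points -/

/-- The projection of the plane onto the torus. -/
def torusMk : (Fin 2 → ℝ) →+ Torus :=
  (QuotientAddGroup.mk' (AddSubgroup.zmultiples (1 : ℝ))).compLeft (Fin 2)

/-- The inclusion of the integer vectors in the plane. -/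
def intVec : (Fin 2 → ℤ) →+ (Fin 2 → ℝ) := (Int.castAddHom ℝ).compLeft (Fin 2)

lemma torusMk_apply (p : Fin 2 → ℝ) (i : Fin 2) : torusMk p i = (p i : UnitAddCircle) := rfl

lemma intVec_apply (z : Fin 2 → ℤ) (i : Fin 2) : intVec z i = (z i : ℝ) := rfl

lemma continuous_torusMk : Continuous torusMk :=
  continuous_pi fun i => (AddCircle.continuous_mk' 1).comp (continuous_apply i)

lemma torusMk_eq_zero_iff {p : Fin 2 → ℝ} : torusMk p = 0 ↔ ∃ z, intVec z = p := by
  simp only [funext_iff, torusMk_apply, Pi.zero_apply, AddCircle.coe_eq_zero_iff, intVec_apply,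
    zsmul_one, Classical.skolem]

lemma torusMk_intVec (z : Fin 2 → ℤ) : torusMk (intVec z) = 0 := torusMk_eq_zero_iff.2 ⟨z, rfl⟩

lemma torusMk_eq_iff {p p' : Fin 2 → ℝ} : torusMk p = torusMk p' ↔ ∃ z, intVec z = p - p' := by
  rw [← sub_eq_zero, ← map_sub, torusMk_eq_zero_iff]

lemma eq_of_torusMk_eq {p p' : Fin 2 → ℝ} (h : torusMk p = torusMk p') (hlt : ‖p - p'‖ < 1) :
    p = p' := by
  obtain ⟨z, hz⟩ := torusMk_eq_iff.1 h
  have hz0 : z = 0 := by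
    funext i
    have hi := (norm_le_pi_norm (p - p') i).trans_lt hlt
    rw [← hz, intVec_apply, Real.norm_eq_abs] at hi
    exact Int.abs_lt_one_iff.1 (by exact_mod_cast hi)
  rwa [hz0, map_zero, eq_comm, sub_eq_zero] at hz

lemma exists_torusMk_eq_norm_le (x : Torus) : ∃ p, torusMk p = x ∧ ‖p‖ ≤ ‖x‖ := by
  have hcoord (i : Fin 2) : ∃ y : ℝ, (y : UnitAddCircle) = x i ∧ ‖y‖ = ‖x i‖ := by
    obtain ⟨y, hy⟩ := QuotientAddGroup.mk_surjective (x i)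
    have hround : ((round y : ℝ) : UnitAddCircle) = 0 :=
      (AddCircle.coe_eq_zero_iff 1).2 ⟨round y, zsmul_one _⟩
    refine ⟨y - round y, ?_, ?_⟩
    · rw [AddCircle.coe_sub, hround, sub_zero, ← hy]
    · rw [← hy]
      exact (UnitAddCircle.norm_eq (x := y)).symm
  choose p hp hnorm using hcoord
  exact ⟨p, funext hp, (pi_norm_le_iff_of_nonneg (norm_nonneg x)).2 fun i =>
    (hnorm i).trans_le (norm_le_pi_norm x i)⟩

lemma torusMk_surjective : Function.Surjective torusMk := fun x =>
  (exists_torusMk_eq_norm_le x).imp fun _ h => h.1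

lemma exists_lift_tendsto_zero {t : ℕ → Torus} (ht : Tendsto t atTop (𝓝 0)) :
    ∃ a : ℕ → Fin 2 → ℝ, (∀ n, torusMk (a n) = t n) ∧ Tendsto a atTop (𝓝 0) := by
  choose a ha hnorm using fun n => exists_torusMk_eq_norm_le (t n)
  exact ⟨a, ha, squeeze_zero_norm hnorm (by simpa using ht.norm)⟩

/-- The linear map of the plane given by an integer matrix. -/
def realAct (N : Matrix (Fin 2) (Fin 2) ℤ) : (Fin 2 → ℝ) →ₗ[ℝ] (Fin 2 → ℝ) :=
  Matrix.toLin' (N.map (Int.cast : ℤ → ℝ))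

section RealAct

variable (N N' : Matrix (Fin 2) (Fin 2) ℤ) (p : Fin 2 → ℝ)

lemma realAct_apply (i : Fin 2) : realAct N p i = N i 0 * p 0 + N i 1 * p 1 := by
  simp [realAct, Matrix.mulVec, dotProduct, Fin.sum_univ_two]

lemma realAct_intVec (z : Fin 2 → ℤ) : realAct N (intVec z) = intVec (N.mulVec z) := by
  funext i
  rw [realAct_apply]
  simp only [intVec_apply, Matrix.mulVec, dotProduct, Fin.sum_univ_two]
  push_cast
  rfl

lemma realAct_mul : realAct (N * N') p = realAct N (realAct N' p) := by
  funext i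
  simp only [realAct_apply, Matrix.mul_apply, Fin.sum_univ_two, Int.cast_add, Int.cast_mul]
  ring

lemma realAct_one : realAct 1 p = p := by
  simp [realAct]

lemma continuous_realAct : Continuous (realAct N) :=
  LinearMap.continuous_of_finiteDimensional _

lemma toralMap_torusMk : toralMap N (torusMk p) = torusMk (realAct N p) := by
  funext i
  change ∑ j, N i j • torusMk p j = _
  rw [Fin.sum_univ_two, torusMk_apply, torusMk_apply, torusMk_apply, realAct_apply,
    AddCircle.coe_add, ← zsmul_eq_mul, ← zsmul_eq_mul, AddCircle.coe_zsmul, AddCircle.coe_zsmul]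

lemma toralMap_mul (x : Torus) : toralMap (N * N') x = toralMap N (toralMap N' x) := by
  obtain ⟨p, rfl⟩ := torusMk_surjective x
  simp only [toralMap_torusMk, realAct_mul]

lemma toralMap_one (x : Torus) : toralMap 1 x = x := by
  obtain ⟨p, rfl⟩ := torusMk_surjective x
  rw [toralMap_torusMk, realAct_one]

lemma toralMap_injective (h : IsUnit N.det) : Function.Injective (toralMap N) :=
  Function.LeftInverse.injective (g := toralMap N⁻¹) fun x => by
    rw [← toralMap_mul, Matrix.nonsing_inv_mul N h, toralMap_one]

lemma eventually_realAct_eq {t t' : ℕ → Torus} {a a' : ℕ → Fin 2 → ℝ}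
    (ht : ∀ n, toralMap N (t n) = t' n) (ha : ∀ n, torusMk (a n) = t n)
    (ha' : ∀ n, torusMk (a' n) = t' n) (hlim : Tendsto a atTop (𝓝 0))
    (hlim' : Tendsto a' atTop (𝓝 0)) : ∀ᶠ n in atTop, realAct N (a n) = a' n := by
  have hdiff : Tendsto (fun n => ‖realAct N (a n) - a' n‖) atTop (𝓝 0) := by
    simpa using ((((continuous_realAct N).tendsto 0).comp hlim).sub hlim').norm
  filter_upwards [hdiff.eventually (gt_mem_nhds one_pos)] with n hn
  exact eq_of_torusMk_eq (by rw [← toralMap_torusMk, ha, ha', ht]) hn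

end RealAct

/-- The linear map sending `(u, v)` to the vector whose components in the expanding and in the
contracting direction are `u` and `v` times those of `l`. -/
def planeMap (N : Matrix (Fin 2) (Fin 2) ℤ) (β μ : ℝ) (l : Fin 2 → ℝ) :
    (ℝ × ℝ) →ₗ[ℝ] (Fin 2 → ℝ) :=
  (LinearMap.fst ℝ ℝ ℝ).smulRight ((β - μ)⁻¹ • (realAct N l - μ • l)) +
    (LinearMap.snd ℝ ℝ ℝ).smulRight ((β - μ)⁻¹ • (β • l - realAct N l))

section PlaneMap

variable {N : Matrix (Fin 2) (Fin 2) ℤ} {β μ : ℝ} {l : Fin 2 → ℝ}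

lemma planeMap_apply (p : ℝ × ℝ) :
    planeMap N β μ l p = p.1 • ((β - μ)⁻¹ • (realAct N l - μ • l)) +
      p.2 • ((β - μ)⁻¹ • (β • l - realAct N l)) := rfl

lemma planeMap_add_mul (h : β ≠ μ) (a b : ℝ) :
    planeMap N β μ l (a + b * β, a + b * μ) = a • l + b • realAct N l := by
  have hsub := sub_ne_zero.2 h
  rw [planeMap_apply]
  funext i
  simp only [Pi.add_apply, Pi.smul_apply, Pi.sub_apply, smul_eq_mul]
  field_simp
  ring

lemma planeMap_eq_of_realAct_eq (h : β ≠ μ) {u v : Fin 2 → ℝ} (hu : realAct N u = β • u)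
    (hv : realAct N v = μ • v) (p : ℝ × ℝ) :
    planeMap N β μ (u + v) p = p.1 • u + p.2 • v := by
  have hinv : (β - μ)⁻¹ * (β - μ) = 1 := inv_mul_cancel₀ (sub_ne_zero.2 h)
  rw [planeMap_apply, map_add, hu, hv]
  funext i
  simp only [Pi.add_apply, Pi.smul_apply, Pi.sub_apply, smul_eq_mul]
  linear_combination (p.1 * u i + p.2 * v i) * hinv

end PlaneMap

lemma eq_zero_of_eq_smul_of_tendsto {E : Type*} [NormedAddCommGroup E] [NormedSpace ℝ E]
    {ρ : ℝ} (hρ : |ρ| ≤ 1) {q : ℕ → E} (hq : ∀ k, q k = ρ • q (k + 1))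
    (hlim : Tendsto q atTop (𝓝 0)) : q 0 = 0 := by
  have hmono : Monotone fun k => ‖q k‖ := monotone_nat_of_le_succ fun k => by
    rw [hq k, norm_smul]
    exact mul_le_of_le_one_left (norm_nonneg _) hρ
  exact norm_le_zero_iff.1 (hmono.ge_of_tendsto (by simpa using hlim.norm) 0)

namespace IsUnitPair

variable {N : Matrix (Fin 2) (Fin 2) ℤ} {β μ : ℝ} (H : IsUnitPair β μ N.trace N.det)

include H

lemma realAct_realAct (p : Fin 2 → ℝ) :
    realAct N (realAct N p) = (β + μ) • realAct N p - (β * μ) • p := by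
  funext i
  rw [H.add_eq, H.mul_eq, Matrix.trace_fin_two, Matrix.det_fin_two]
  simp only [realAct_apply, Pi.sub_apply, Pi.smul_apply, smul_eq_mul]
  push_cast
  fin_cases i <;> simp only [Fin.mk_zero, Fin.mk_one] <;> ring

lemma realAct_planeMap (l : Fin 2 → ℝ) (p : ℝ × ℝ) :
    realAct N (planeMap N β μ l p) = planeMap N β μ l (β * p.1, μ * p.2) := by
  simp only [planeMap_apply, map_add, map_smul, map_sub, H.realAct_realAct]
  module

/-- By Cayley–Hamilton, `N - β` maps a backward orbit of `N` to a backward orbit of `μ`, which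
tends to zero only if it vanishes. -/
lemma realAct_eq_smul_of_backward_orbit {a : ℕ → Fin 2 → ℝ}
    (ha : ∀ k, realAct N (a (k + 1)) = a k) (hlim : Tendsto a atTop (𝓝 0)) :
    realAct N (a 0) = β • a 0 := by
  refine sub_eq_zero.1 (eq_zero_of_eq_smul_of_tendsto (q := fun k => realAct N (a k) - β • a k)
    H.abs_lt_one.le (fun k => ?_) ?_)
  · rw [← ha k, H.realAct_realAct]
    module
  · simpa using (((continuous_realAct N).tendsto 0).comp hlim).sub (hlim.const_smul β)

lemma realAct_eq_smul_of_forward_orbit {a : ℕ → Fin 2 → ℝ}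
    (ha : ∀ k, realAct N (a k) = a (k + 1)) (hlim : Tendsto a atTop (𝓝 0)) :
    realAct N (a 0) = μ • a 0 := by
  have hβ : |β⁻¹| ≤ 1 := by
    rw [abs_of_pos (inv_pos.2 H.pos)]
    exact inv_le_one_of_one_le₀ H.one_lt.le
  refine sub_eq_zero.1 (eq_zero_of_eq_smul_of_tendsto (q := fun k => realAct N (a k) - μ • a k)
    hβ (fun k => ?_) ?_)
  · rw [eq_inv_smul_iff₀ H.pos.ne', ← ha k, H.realAct_realAct]
    module
  · simpa using (((continuous_realAct N).tendsto 0).comp hlim).sub (hlim.const_smul μ)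

lemma exists_unstable_lift {t : ℕ → Torus} (ht : ∀ n, toralMap N (t (n + 1)) = t n)
    (hlim : Tendsto t atTop (𝓝 0)) : ∃ p, torusMk p = t 0 ∧ realAct N p = β • p := by
  obtain ⟨a, ha, halim⟩ := exists_lift_tendsto_zero hlim
  obtain ⟨n₀, hn₀⟩ := eventually_atTop.1 (eventually_realAct_eq N ht (fun n => ha (n + 1)) ha
    (halim.comp (tendsto_add_atTop_nat 1)) halim)
  have heigen : realAct N (a n₀) = β • a n₀ := by
    simpa only [zero_add] using H.realAct_eq_smul_of_backward_orbit (a := fun k => a (k + n₀))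
      (fun k => by rw [← hn₀ (k + n₀) (by omega), add_right_comm])
      (halim.comp (tendsto_add_atTop_nat n₀))
  suffices h : ∀ n p, torusMk p = t n → realAct N p = β • p →
      ∃ p, torusMk p = t 0 ∧ realAct N p = β • p from h n₀ _ (ha n₀) heigen
  intro n
  induction n with
  | zero => exact fun p hp hβ => ⟨p, hp, hβ⟩
  | succ n ih =>
    exact fun p hp hβ => ih (β • p) (by rw [← hβ, ← toralMap_torusMk, hp, ht])
      (by rw [map_smul, hβ])

lemma exists_stable_lift {t : ℕ → Torus} (ht : ∀ n, toralMap N (t n) = t (n + 1))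
    (hlim : Tendsto t atTop (𝓝 0)) : ∃ p, torusMk p = t 0 ∧ realAct N p = μ • p := by
  obtain ⟨a, ha, halim⟩ := exists_lift_tendsto_zero hlim
  obtain ⟨n₀, hn₀⟩ := eventually_atTop.1 (eventually_realAct_eq N ht ha (fun n => ha (n + 1))
    halim (halim.comp (tendsto_add_atTop_nat 1)))
  have heigen : realAct N (a n₀) = μ • a n₀ := by
    simpa only [zero_add] using H.realAct_eq_smul_of_forward_orbit (a := fun k => a (k + n₀))
      (fun k => by rw [hn₀ (k + n₀) (by omega), add_right_comm])
      (halim.comp (tendsto_add_atTop_nat n₀))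
  suffices h : ∀ n p, torusMk p = t n → realAct N p = μ • p →
      ∃ p, torusMk p = t 0 ∧ realAct N p = μ • p from h n₀ _ (ha n₀) heigen
  intro n
  induction n with
  | zero => exact fun p hp hμ => ⟨p, hp, hμ⟩
  | succ n ih =>
    refine fun p hp hμ => ih (μ⁻¹ • p) (toralMap_injective N H.isUnit_norm ?_) (by
      rw [map_smul, hμ, smul_comm])
    rw [toralMap_torusMk, map_smul, hμ, inv_smul_smul₀ H.ne_zero, hp, ht]

/-- Homoclinic points of a hyperbolic toral automorphism are the projections of the contracting
components of integer vectors. -/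
theorem exists_eq_torusMk_planeMap {t : ℤ → Torus} (ht : ∀ n, toralMap N (t n) = t (n - 1))
    (hpos : Tendsto (fun n : ℕ => t n) atTop (𝓝 0))
    (hneg : Tendsto (fun n : ℕ => t (-n)) atTop (𝓝 0)) :
    ∃ l : Fin 2 → ℤ, t 0 = torusMk (planeMap N β μ (intVec l) (0, -1)) := by
  obtain ⟨u, hu, hβ⟩ := H.exists_unstable_lift (fun n => by
    rw [ht, Nat.cast_add_one, add_sub_cancel_right]) hpos
  obtain ⟨v, hv, hμ⟩ := H.exists_stable_lift (fun n => by
    rw [ht, Nat.cast_add_one, neg_add']) hneg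
  obtain ⟨l, hl⟩ := torusMk_eq_iff.1 (hu.trans (hv.trans (congrArg t neg_zero)).symm)
  have hμ' : realAct N (-v) = μ • -v := by rw [map_neg, hμ, smul_neg]
  refine ⟨l, ?_⟩
  rw [hl, sub_eq_add_neg, planeMap_eq_of_realAct_eq H.ne_conj hβ hμ']
  simpa using hv.symm

end IsUnitPair

/-- The homomorphism from the symbolic space to the torus attached to an integer vector `l`; it
maps the sequence with the single nonzero digit `ε₀ = 1` to the homoclinic point given by `l`. -/
def codingHom {N : Matrix (Fin 2) (Fin 2) ℤ} {β μ : ℝ} (H : IsUnitPair β μ N.trace N.det)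
    (l : Fin 2 → ℤ) : SymbolicSpace β →+ Torus :=
  torusMk.comp ((planeMap N β μ (intVec l)).toAddMonoidHom.comp H.codingPair)

section CodingHom

variable {N : Matrix (Fin 2) (Fin 2) ℤ} {β μ : ℝ} (H : IsUnitPair β μ N.trace N.det)
  (l : Fin 2 → ℤ)

lemma codingHom_apply (ε : SymbolicSpace β) :
    codingHom H l ε = torusMk (planeMap N β μ (intVec l) (H.codingPair ε)) := rfl

lemma continuous_codingHom : Continuous (codingHom H l) :=
  continuous_torusMk.comp
    ((LinearMap.continuous_of_finiteDimensional (planeMap N β μ (intVec l))).comp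
      H.continuous_codingPair)

lemma planeMap_intVec (h : β ≠ μ) (a b : ℤ) :
    planeMap N β μ (intVec l) (a + b * β, a + b * μ) = intVec (a • l + b • N.mulVec l) := by
  rw [planeMap_add_mul h, realAct_intVec, Int.cast_smul_eq_zsmul, Int.cast_smul_eq_zsmul, map_add,
    map_zsmul, map_zsmul]

include H in
lemma torusMk_planeMap_of_mem {p : ℝ × ℝ} (hp : p ∈ conjLattice β μ) :
    torusMk (planeMap N β μ (intVec l) p) = 0 := by
  obtain ⟨a, b, h₁, h₂⟩ := hp
  rw [show p = (a + b * β, a + b * μ) from Prod.ext h₁ h₂,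
    planeMap_intVec l H.ne_conj, torusMk_intVec]

lemma codingHom_shift (ε : SymbolicSpace β) :
    codingHom H l ε.shift = toralMap N (codingHom H l ε) := by
  rw [codingHom_apply, codingHom_apply, toralMap_torusMk, H.realAct_planeMap,
    H.codingPair_shift, eq_comm, ← sub_eq_zero, ← map_sub, ← map_sub]
  refine torusMk_planeMap_of_mem H l ?_
  simpa using intCast_mem_conjLattice β μ (ε.digit 1)

theorem exists_eq_codingHom {φ : SymbolicSpace β →+ Torus} (hφ : Continuous φ)
    (hshift : ∀ ε, φ ε.shift = toralMap N (φ ε)) : ∃ l, φ = codingHom H l := by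
  have hinj := toralMap_injective N H.isUnit_norm
  have hlim : Tendsto φ (𝓝 0) (𝓝 0) := hφ.tendsto' 0 0 (map_zero φ)
  obtain ⟨l, hl⟩ := H.exists_eq_torusMk_planeMap (t := fun n => φ (single β n))
    (fun n => by rw [← hshift, shift_single])
    (hlim.comp (tendsto_single_atTop H.one_lt)) (hlim.comp (tendsto_single_neg_atTop H.one_lt))
  refine ⟨l, hom_ext hφ (continuous_codingHom H l) fun n => ?_⟩
  induction n using Int.induction_on with
  | zero => rw [hl, codingHom_apply, H.codingPair_single_zero]
  | succ n ih =>
    refine hinj ?_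
    rw [← hshift, ← codingHom_shift, shift_single, add_sub_cancel_right, ih]
  | pred n ih => rw [← shift_single, hshift, codingHom_shift, ih]

end CodingHom

/-! ### Sequences bounded away from the quasi-greedy expansion of one -/

lemma value_zero (β : ℝ) : value β 0 = 0 := by simp [value]

lemma summableValue_zero (β : ℝ) : SummableValue β 0 := by simp [SummableValue]

lemma value_splice_zero {β : ℝ} (hβ : β ≠ 0) {v : ℕ → ℕ} (hv : SummableValue β v) (n : ℕ) :
    value β (splice 0 n v) = (β ^ n)⁻¹ * value β v := by
  have h := value_sub_value hβ (hv.splice (a := 0) (n := n)) (summableValue_zero β)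
    fun i hi => splice_of_lt hi
  rwa [tail_splice_self, show tail (0 : ℕ → ℕ) n = 0 from rfl, value_zero, sub_zero,
    sub_zero] at h

lemma tail_splice_of_le {a v : ℕ → ℕ} {n k : ℕ} (hk : n ≤ k) :
    tail (splice a n v) k = tail v (k - n) := by
  obtain ⟨m, rfl⟩ := Nat.exists_eq_add_of_le hk
  rw [← Nat.cast_id m, ← tail_tail, tail_splice_self, Nat.cast_id, Nat.add_sub_cancel_left]

namespace QuasiGreedy

variable {β : ℝ} {q p : ℕ → ℕ} (H : QuasiGreedy β q)

include H

lemma admissible : Admissible q q := fun k => le_of_not_gt fun hlt =>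
  (H.value_tail_le_one k).not_gt <| by
    simpa only [H.value_eq_one] using value_lt_value_of_toLex_lt H.pos H.summable
      (H.summable.tail H.pos.ne' k) H.value_tail_le_one
      (fun i => by rw [tail_tail]; exact H.value_tail_pos _) hlt

lemma value_tail_splice_lt_one {a v : ℕ → ℕ} (h : Admissible q a) (hv : SummableValue β v)
    (hlt : ∀ k, value β v < value β (tail q k)) (hv1 : ∀ k, value β (tail v k) < 1) (n k : ℕ) :
    value β (tail (splice a n v) k) < 1 := by
  rcases le_total k n with hk | hk
  · rw [tail_splice hk]
    exact H.value_splice_lt_one hv hlt (h.tail k) _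
  · rw [tail_splice_of_le hk]
    exact hv1 _

lemma exists_toLex_lt_value_tail_lt_one (hp : toLex p < toLex q) :
    ∃ w, SummableValue β w ∧ (∀ k, value β (tail w k) < 1) ∧ toLex p < toLex w := by
  obtain ⟨j, hj, hlt⟩ := hp
  refine ⟨splice q (j + 1) 0, (summableValue_zero β).splice,
    H.value_tail_splice_lt_one H.admissible (summableValue_zero β)
      (fun k => by rw [value_zero]; exact H.value_tail_pos k)
      (fun k => by rw [show tail (0 : ℕ → ℕ) k = 0 from rfl, value_zero]; exact one_pos) _,
    j, fun i hi => ?_, ?_⟩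
  · exact (hj i hi).trans (splice_of_lt (by omega)).symm
  · exact hlt.trans_eq (splice_of_lt (by omega)).symm

lemma exists_small_toLex_lt_tail (hp : toLex p < toLex q) {c : ℝ} (hc : 0 < c) :
    ∃ v M, SummableValue β v ∧ (∀ k, value β (tail v k) < 1) ∧ value β v < c ∧
      toLex p < toLex (tail v M) := by
  obtain ⟨w, hw, hw1, hpw⟩ := H.exists_toLex_lt_value_tail_lt_one hp
  obtain ⟨M, hM⟩ := exists_pow_lt_of_lt_one hc (inv_lt_one_of_one_lt₀ H.one_lt)
  have hinv : ∀ n, value β (splice 0 n w) < (β ^ n)⁻¹ := fun n => by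
    rw [value_splice_zero H.pos.ne' hw]
    exact mul_lt_of_lt_one_right (inv_pos.2 (pow_pos H.pos n)) (by simpa using hw1 0)
  refine ⟨splice 0 M w, M, hw.splice, fun k => ?_, ?_, ?_⟩
  · rcases le_total k M with hk | hk
    · rw [tail_splice hk]
      exact (hinv _).trans_le (inv_le_one_of_one_le₀ (one_le_pow₀ H.one_lt.le))
    · rw [tail_splice_of_le hk]
      exact hw1 _
  · exact (hinv M).trans (by rwa [← inv_pow])
  · rwa [tail_splice_self]

lemma tendsto_value_splice {a v : ℕ → ℕ} (ha : Admissible q a) (hv : SummableValue β v) :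
    Tendsto (fun n => value β (splice a n v)) atTop (𝓝 (value β a)) := by
  rw [tendsto_iff_dist_tendsto_zero]
  refine squeeze_zero (fun _ => dist_nonneg) (fun n => ?_) (by
    simpa using (tendsto_inv_atTop_zero.comp (tendsto_pow_atTop_atTop_of_one_lt H.one_lt)).mul_const
      (value β v + 1))
  rw [Real.dist_eq, value_sub_value H.pos.ne' hv.splice (H.summable_of_admissible ha)
    fun i hi => splice_of_lt hi, tail_splice_self, abs_mul,
    abs_of_pos (inv_pos.2 (pow_pos H.pos n))]
  refine mul_le_mul_of_nonneg_left (abs_le.2 ⟨?_, ?_⟩) (inv_pos.2 (pow_pos H.pos n)).le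
  · linarith [value_nonneg H.pos.le v, H.value_tail_le_one_of_admissible ha n]
  · linarith [value_nonneg H.pos.le (tail a n)]

theorem interior_future_image (hp : toLex p < toLex q) :
    interior ((fun e : ℤ → ℕ => future β e 0) '' {e | Admissible p e}) = ∅ := by
  refine Set.eq_empty_of_forall_notMem fun x hx => ?_
  obtain ⟨e, he, rfl⟩ := interior_subset hx
  have hlt : ∀ f : ℤ → ℕ, Admissible p f → ∀ n, toLex (tail f n) < toLex q :=
    fun f hf n => (hf n).trans_lt hp
  have hadm : ∀ f : ℤ → ℕ, Admissible p f → Admissible q (tail f (0 + 1)) := fun f hf =>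
    Admissible.tail (fun n => (hlt f hf n).le) _
  obtain ⟨c, hc, hcq⟩ := H.exists_pos_le_value_tail
  obtain ⟨v, M, hv, hv1, hvc, hpv⟩ := H.exists_small_toLex_lt_tail hp hc
  obtain ⟨n, f, hf, hfn : value β (tail f (0 + 1)) = _⟩ :=
    ((H.tendsto_value_splice (hadm e he) hv).eventually
      (mem_interior_iff_mem_nhds.1 hx)).exists
  have hfa : tail f (0 + 1) = splice (tail e (0 + 1)) n v :=
    eq_of_value_eq H.pos (H.summable_of_admissible (hadm f hf)) hv.splice
      (fun k => by
        rw [tail_tail]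
        exact H.value_lt_one (fun i => by rw [tail_tail]; exact (hlt f hf _).le) (hlt f hf _))
      (H.value_tail_splice_lt_one (hadm e he) hv (fun k => hvc.trans_le (hcq k)) hv1 n) hfn
  have htail : tail f (0 + 1 + ↑(n + M)) = tail v M := by
    rw [← tail_tail, hfa, tail_splice_of_le (Nat.le_add_right n M), Nat.add_sub_cancel_left]
  exact (hf _).not_gt (htail ▸ hpv)

lemma toLex_tail_lt_of_finite {e : ℤ → ℕ} (h : Admissible q e) (hfin : {n | e n ≠ 0}.Finite)
    (k : ℤ) : toLex (tail e k) < toLex q := by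
  refine lt_of_le_of_ne (h k) fun heq => ?_
  obtain ⟨m, hm⟩ := hfin.bddAbove
  have hzero : tail q (m + 1 - k).toNat = 0 := by
    funext i
    rw [← toLex.injective heq, tail_apply, tail_apply]
    by_contra hne
    have : k + ((m + 1 - k).toNat + i : ℕ) ≤ m := hm hne
    omega
  have hpos := H.value_tail_pos (m + 1 - k).toNat
  rw [hzero, value_zero] at hpos
  exact lt_irrefl _ hpos

theorem exists_admissible_of_finite {e : ℤ → ℕ} (h : Admissible q e)
    (hfin : {n | e n ≠ 0}.Finite) : ∃ p, toLex p < toLex q ∧ Admissible p e := by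
  -- bounds the tails of `e` that start with the digit zero
  let p₀ : ℕ → ℕ := fun i => if i = 0 then 0 else q 0
  have hp₀ : toLex p₀ < toLex q := ⟨0, by simp, H.one_le_zero⟩
  obtain ⟨p, hp, hmax⟩ := Set.exists_max_image
    (insert (toLex p₀) ((fun k => toLex (tail e k)) '' {n | e n ≠ 0})) id
    ((hfin.image _).insert _) ⟨_, Set.mem_insert _ _⟩
  refine ⟨ofLex p, ?_, fun k => ?_⟩
  · rcases hp with rfl | ⟨k, -, rfl⟩
    exacts [hp₀, H.toLex_tail_lt_of_finite h hfin k]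
  · by_cases hk : e k = 0
    · refine le_trans (Pi.toLex_monotone fun i => ?_) (hmax _ (Set.mem_insert _ _))
      rcases i with - | i
      · simp [tail_apply, hk]
      · exact h.le_zero _
    · exact hmax _ (Set.mem_insert_of_mem _ ⟨k, hk, rfl⟩)

end QuasiGreedy

/-! ### Arithmetic codings and generators of the integer lattice -/

/-- The determinant of the matrix with columns `l` and `N l`: up to sign, the index in `ℤ²` of the
subgroup that `l` and `N l` generate. -/
def cyclicDet (N : Matrix (Fin 2) (Fin 2) ℤ) (l : Fin 2 → ℤ) : ℤ :=
  l 0 * N.mulVec l 1 - l 1 * N.mulVec l 0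

lemma associatedForm_eq_neg_cyclicDet (N : Matrix (Fin 2) (Fin 2) ℤ) (l : Fin 2 → ℤ) :
    associatedForm N (l 1) (-l 0) = -cyclicDet N l := by
  simp only [associatedForm, cyclicDet, Matrix.mulVec, dotProduct, Fin.sum_univ_two]
  ring

lemma cramer_smul {R : Type*} [CommRing R] (u v z : Fin 2 → R) :
    (u 0 * v 1 - u 1 * v 0) • z =
      (z 0 * v 1 - z 1 * v 0) • u + (u 0 * z 1 - u 1 * z 0) • v := by
  funext i
  fin_cases i <;> simp <;> ring

section CyclicDet

variable {N : Matrix (Fin 2) (Fin 2) ℤ} {β μ : ℝ} (H : IsUnitPair β μ N.trace N.det)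
  {l : Fin 2 → ℤ}

include H

lemma cyclicDet_ne_zero (hl : l ≠ 0) : cyclicDet N l ≠ 0 := fun h => by
  obtain ⟨i, hi : l i ≠ 0⟩ := Function.ne_iff.1 hl
  have hi' : (l i : ℝ) ≠ 0 := Int.cast_ne_zero.2 hi
  have hprop : ∀ j, N.mulVec l j * l i = N.mulVec l i * l j := by
    rw [cyclicDet] at h
    intro j
    fin_cases i <;> fin_cases j <;> simp only [Fin.mk_zero, Fin.mk_one] <;> linarith
  set ρ : ℝ := N.mulVec l i / l i with hρ
  have heigen : realAct N (intVec l) = ρ • intVec l := by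
    funext j
    rw [realAct_intVec, Pi.smul_apply, intVec_apply, intVec_apply, smul_eq_mul, hρ,
      div_mul_eq_mul_div, eq_div_iff hi']
    exact_mod_cast hprop j
  have hroot : (ρ - β) * (ρ - μ) = 0 := by
    have h2 := congrFun (H.realAct_realAct (intVec l)) i
    simp only [heigen, map_smul, Pi.sub_apply, Pi.smul_apply, smul_eq_mul, intVec_apply] at h2
    refine (mul_eq_zero.1 (?_ : _ * (l i : ℝ) = 0)).resolve_right hi'
    linear_combination h2
  have hrat : ¬ Irrational ρ := fun hirr => hirr ⟨N.mulVec l i / l i, by rw [hρ]; push_cast; rfl⟩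
  rcases mul_eq_zero.1 hroot with h0 | h0
  · exact hrat (sub_eq_zero.1 h0 ▸ H.irrational)
  · exact hrat (sub_eq_zero.1 h0 ▸ H.irrational_conj)

lemma planeMap_surjective (hl : cyclicDet N l ≠ 0) :
    Function.Surjective (planeMap N β μ (intVec l)) := fun p => by
  have hD : intVec l 0 * intVec (N.mulVec l) 1 - intVec l 1 * intVec (N.mulVec l) 0 ≠ 0 := by
    simp only [intVec_apply]
    exact_mod_cast hl
  rw [← inv_smul_smul₀ hD p, cramer_smul, ← realAct_intVec, ← planeMap_add_mul H.ne_conj,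
    ← map_smul]
  exact ⟨_, rfl⟩

lemma planeMap_injective (hl : cyclicDet N l ≠ 0) :
    Function.Injective (planeMap N β μ (intVec l)) :=
  (LinearMap.injective_iff_surjective_of_finrank_eq_finrank (by simp)).2
    (planeMap_surjective H hl)

lemma mem_conjLattice_of_torusMk_eq_zero (hl : IsUnit (cyclicDet N l)) {p : ℝ × ℝ}
    (hp : torusMk (planeMap N β μ (intVec l) p) = 0) : p ∈ conjLattice β μ := by
  obtain ⟨z, hz⟩ := torusMk_eq_zero_iff.1 hp
  obtain ⟨a, b, hab⟩ : ∃ a b : ℤ, z = a • l + b • N.mulVec l := by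
    refine ⟨cyclicDet N l * (z 0 * N.mulVec l 1 - z 1 * N.mulVec l 0),
      cyclicDet N l * (l 0 * z 1 - l 1 * z 0), ?_⟩
    rw [mul_smul, mul_smul, ← smul_add, ← cramer_smul, ← cyclicDet, smul_smul,
      Int.isUnit_mul_self hl, one_smul]
  rw [hab, ← planeMap_intVec l H.ne_conj] at hz
  have := planeMap_injective H hl.ne_zero hz
  exact ⟨a, b, congrArg Prod.fst this.symm, congrArg Prod.snd this.symm⟩

lemma isUnit_cyclicDet (hl : cyclicDet N l ≠ 0)
    (h : ∀ p, torusMk (planeMap N β μ (intVec l) p) = 0 → p ∈ conjLattice β μ) :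
    IsUnit (cyclicDet N l) := by
  have hspan : ∀ z : Fin 2 → ℤ, ∃ a b : ℤ, ∀ i, z i = a * l i + b * N.mulVec l i := fun z => by
    obtain ⟨p, hp⟩ := planeMap_surjective H hl (intVec z)
    obtain ⟨a, b, h₁, h₂⟩ := h p (by rw [hp, torusMk_intVec])
    rw [show p = (a + b * β, a + b * μ) from Prod.ext h₁ h₂, planeMap_intVec l H.ne_conj] at hp
    exact ⟨a, b, fun i => Int.cast_injective (congrFun hp i).symm⟩
  obtain ⟨a, b, h₁⟩ := hspan ![1, 0]
  obtain ⟨a', b', h₂⟩ := hspan ![0, 1]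
  refine IsUnit.of_mul_eq_one (a * b' - b * a') ?_
  calc cyclicDet N l * (a * b' - b * a')
      = (a * l 0 + b * N.mulVec l 0) * (a' * l 1 + b' * N.mulVec l 1) -
        (a * l 1 + b * N.mulVec l 1) * (a' * l 0 + b' * N.mulVec l 0) := by
        rw [cyclicDet]
        ring
    _ = 1 := by
        rw [← h₁, ← h₁, ← h₂, ← h₂]
        simp

end CyclicDet

lemma exists_torus_ne_zero : ∃ x : Torus, x ≠ 0 := by
  refine ⟨torusMk fun _ => 1 / 2, fun h => ?_⟩
  have := eq_of_torusMk_eq (h.trans (map_zero torusMk).symm)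
    (by rw [sub_zero, pi_norm_const]; norm_num)
  exact absurd (congrFun this 0) (by norm_num)

lemma IsUnitPair.exists_admissible_sub_codingPair_mem {β μ : ℝ} {r σ : ℤ}
    (H : IsUnitPair β μ r σ) (p : ℝ × ℝ) :
    ∃ ε : SymbolicSpace β, Admissible (quasiGreedyDigits r σ) ε.digit ∧
      p - H.codingPair ε ∈ conjLattice β μ := by
  obtain ⟨e, he, hp⟩ := mem_representedPoints.1 (H.representedPoints_eq_univ ▸ Set.mem_univ p)
  exact ⟨ofBounded H.one_lt e he.le_zero, he, hp⟩

section CodingHom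

variable {N : Matrix (Fin 2) (Fin 2) ℤ} {β μ : ℝ} (H : IsUnitPair β μ N.trace N.det)

lemma codingHom_eq_of_sub_mem (l : Fin 2 → ℤ) {ε : SymbolicSpace β} {p : ℝ × ℝ}
    (h : p - H.codingPair ε ∈ conjLattice β μ) :
    codingHom H l ε = torusMk (planeMap N β μ (intVec l) p) := by
  have := torusMk_planeMap_of_mem H l h
  rw [map_sub, map_sub, sub_eq_zero] at this
  exact this.symm

lemma codingHom_zero : codingHom H 0 = 0 := by
  ext1 ε
  rw [codingHom_apply, planeMap_apply]
  simp

/-- Baire: the plane would be a countable union of translates of a closed set whose first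
projection has empty interior. -/
theorem not_surjective_codingHom {l : Fin 2 → ℤ} (hl : cyclicDet N l ≠ 0)
    {X : Set (SymbolicSpace β)} {p : ℕ → ℕ} (hp : toLex p < toLex (quasiGreedyDigits N.trace N.det))
    (hX : ∀ ε ∈ X, Admissible p ε.digit) : ¬ ∀ x : Torus, ∃ ε ∈ X, codingHom H l ε = x := by
  intro hsurj
  choose c hc using fun z : Fin 2 → ℤ => planeMap_surjective H hl (intVec z)
  set S := (fun e : ℤ → ℕ => future β e 0) '' {e | Admissible p e} with hS
  have hclosed : IsClosed S :=
    ((isCompact_setOf_admissible p).image_of_continuousOn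
      (continuousOn_future H.one_lt p 0)).isClosed
  have hcover : ⋃ z : Fin 2 → ℤ, (Homeomorph.subRight (c z).1) ⁻¹' S = Set.univ := by
    refine Set.eq_univ_of_forall fun u => ?_
    obtain ⟨ε, hε, h⟩ := hsurj (torusMk (planeMap N β μ (intVec l) (u, 0)))
    rw [codingHom_apply] at h
    obtain ⟨z, hz⟩ := torusMk_eq_iff.1 h.symm
    rw [← map_sub, ← hc z] at hz
    have hfst : (c z).1 = u - future β ε.digit 0 :=
      congrArg Prod.fst (planeMap_injective H hl hz)
    exact Set.mem_iUnion.2 ⟨z, ε.digit, hX ε hε, eq_sub_of_add_eq' (by rw [hfst]; ring)⟩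
  obtain ⟨z, hz⟩ := nonempty_interior_of_iUnion_of_closed
    (fun z => hclosed.preimage (Homeomorph.subRight (c z).1).continuous) hcover
  rw [← Homeomorph.preimage_interior, hS, H.quasiGreedy.interior_future_image hp,
    Set.preimage_empty] at hz
  exact Set.not_nonempty_empty hz

theorem mem_of_admissible {l : Fin 2 → ℤ} (hl : cyclicDet N l ≠ 0) {X : Set (SymbolicSpace β)}
    (hcl : IsClosed X) (htot : IsTotal X)
    (hsurj : ∀ x : Torus, ∃ ε ∈ X, codingHom H l ε = x) {ε : SymbolicSpace β}
    (hε : Admissible (quasiGreedyDigits N.trace N.det) ε.digit) : ε ∈ X := by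
  have hfinite : ∀ f : SymbolicSpace β, Admissible (quasiGreedyDigits N.trace N.det) f.digit →
      f.IsFinite → f ∈ X := by
    intro f hf hfin
    by_contra hfX
    obtain ⟨p, hp, hfp⟩ := H.quasiGreedy.exists_admissible_of_finite hf hfin
    refine not_surjective_codingHom H hl hp (fun ε hε n => ?_) hsurj
    by_contra! hlt
    exact hfX (htot ε hε f ⟨n, fun k => (hfp k).trans_lt hlt⟩)
  refine hcl.mem_of_tendsto ε.tendsto_trunc (Eventually.of_forall fun m => ?_)
  refine hfinite _ (fun k => le_trans (Pi.toLex_monotone fun i => ?_) (hε k)) (isFinite_ofFinite _)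
  rw [tail_apply, digit_trunc]
  split_ifs
  exacts [le_rfl, Nat.zero_le _]

end CodingHom

/-- If `l` and `N l` do not generate `ℤ²`, some `w` outside `conjLattice` maps to `0`; expansions
of `p` and `p + w` are then distinct preimages of the same point. -/
theorem exists_isUnit_cyclicDet {N : Matrix (Fin 2) (Fin 2) ℤ} {μ : ℝ}
    (H : IsUnitPair (leadingEigenvalue N) μ N.trace N.det)
    {φ : SymbolicSpace (leadingEigenvalue N) →+ Torus}
    {X : Set (SymbolicSpace (leadingEigenvalue N))} (hX : IsArithmeticCoding N φ X)
    (huniq : ∃ x, ∃! ε, ε ∈ X ∧ φ ε = x) : ∃ l, IsUnit (cyclicDet N l) := by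
  obtain ⟨l, rfl⟩ := exists_eq_codingHom H hX.continuous hX.map_shift
  have hl : cyclicDet N l ≠ 0 := cyclicDet_ne_zero H <| by
    rintro rfl
    obtain ⟨x, hx⟩ := exists_torus_ne_zero
    obtain ⟨ε, -, hε⟩ := hX.surjective x
    rw [codingHom_zero] at hε
    exact hx hε.symm
  refine ⟨l, isUnit_cyclicDet H hl fun w hw => ?_⟩
  obtain ⟨x, ε₀, -, hε₀⟩ := huniq
  obtain ⟨y, rfl⟩ := torusMk_surjective x
  obtain ⟨p, rfl⟩ := planeMap_surjective H hl y
  have heq : ∀ p', torusMk (planeMap N _ μ (intVec l) p') = torusMk (planeMap N _ μ (intVec l) p) →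
      p' - H.codingPair ε₀ ∈ conjLattice _ μ := fun p' hp' => by
    obtain ⟨ε, hε, hεp⟩ := H.exists_admissible_sub_codingPair_mem p'
    rwa [← hε₀ ε ⟨mem_of_admissible H hl hX.isClosed hX.total hX.surjective hε,
      (codingHom_eq_of_sub_mem H l hεp).trans hp'⟩]
  simpa using sub_mem (heq (p + w) (by rw [map_add, map_add, hw, add_zero])) (heq p rfl)

/-! ### Fundamental domains and uniqueness almost everywhere -/

/-- The half-open unit square. -/
def unitBox : Set (Fin 2 → ℝ) := Set.univ.pi fun _ => Set.Ioc 0 (0 + 1)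

lemma measurableSet_unitBox : MeasurableSet unitBox :=
  MeasurableSet.univ_pi fun _ => measurableSet_Ioc

lemma measurePreserving_torusMk :
    MeasurePreserving torusMk (volume.restrict unitBox) volume := by
  have h := measurePreserving_pi
    (fun _ : Fin 2 => (volume : Measure ℝ).restrict (Set.Ioc 0 (0 + 1)))
    (fun _ : Fin 2 => (volume : Measure UnitAddCircle)) fun _ =>
      UnitAddCircle.measurePreserving_mk 0
  rwa [← Measure.restrict_pi_pi] at h

lemma injOn_torusMk_unitBox : Set.InjOn torusMk unitBox := by
  intro p hp p' hp' h
  obtain ⟨z, hz⟩ := torusMk_eq_iff.1 h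
  funext i
  have hzi : (z i : ℝ) = p i - p' i := congrFun hz i
  obtain ⟨hpos, hle⟩ := hp i trivial
  obtain ⟨hpos', hle'⟩ := hp' i trivial
  have habs : |(z i : ℝ)| < 1 := by
    rw [hzi, abs_lt]
    constructor <;> linarith
  have hzero : z i = 0 := Int.abs_lt_one_iff.1 (by exact_mod_cast habs)
  rw [hzero, Int.cast_zero] at hzi
  exact (sub_eq_zero.1 hzi.symm)

lemma exists_intVec_add_mem_unitBox (p : Fin 2 → ℝ) : ∃ z, intVec z + p ∈ unitBox := by
  refine ⟨fun i => 1 - ⌈p i⌉, fun i _ => ?_⟩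
  rw [Pi.add_apply, intVec_apply]
  have hlt := Int.ceil_lt_add_one (p i)
  have hle := Int.le_ceil (p i)
  push_cast
  constructor <;> linarith

instance : Countable intVec.range := (Set.countable_range intVec).to_subtype

lemma isAddFundamentalDomain_unitBox : IsAddFundamentalDomain intVec.range unitBox := by
  refine .mk' measurableSet_unitBox.nullMeasurableSet fun p => ?_
  obtain ⟨z, hz⟩ := exists_intVec_add_mem_unitBox p
  refine ⟨⟨intVec z, z, rfl⟩, hz, ?_⟩
  rintro ⟨_, z', rfl⟩ hz'
  refine Subtype.ext (add_right_cancel (injOn_torusMk_unitBox (x₁ := intVec z' + p) hz' hz ?_))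
  simp only [map_add, torusMk_intVec]

lemma volume_torusMk_image_of_subset_unitBox {E : Set (Fin 2 → ℝ)} (hE : MeasurableSet E)
    (hsub : E ⊆ unitBox) : volume (torusMk '' E) = volume E := by
  have himage : MeasurableSet (torusMk '' E) :=
    hE.image_of_continuousOn_injOn continuous_torusMk.continuousOn (injOn_torusMk_unitBox.mono hsub)
  rw [← measurePreserving_torusMk.measure_preimage himage.nullMeasurableSet,
    Measure.restrict_apply (himage.preimage continuous_torusMk.measurable),
    injOn_torusMk_unitBox.preimage_image_inter hsub]

lemma volume_torusMk_image_le {E : Set (Fin 2 → ℝ)} (hE : MeasurableSet E) :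
    volume (torusMk '' E) ≤ volume E := by
  have hcover : torusMk '' E ⊆ ⋃ g : intVec.range, torusMk '' ((g +ᵥ E) ∩ unitBox) := by
    rintro _ ⟨p, hp, rfl⟩
    obtain ⟨z, hz⟩ := exists_intVec_add_mem_unitBox p
    refine Set.mem_iUnion.2 ⟨⟨intVec z, z, rfl⟩, intVec z + p, ⟨⟨p, hp, rfl⟩, hz⟩, ?_⟩
    rw [map_add, torusMk_intVec, zero_add]
  calc volume (torusMk '' E)
      ≤ ∑' g : intVec.range, volume (torusMk '' ((g +ᵥ E) ∩ unitBox)) :=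
        (measure_mono hcover).trans (measure_iUnion_le _)
    _ = ∑' g : intVec.range, volume ((g +ᵥ E) ∩ unitBox) := tsum_congr fun g =>
        volume_torusMk_image_of_subset_unitBox
          ((hE.const_vadd g).inter measurableSet_unitBox) Set.inter_subset_right
    _ = volume E := (isAddFundamentalDomain_unitBox.measure_eq_tsum E).symm

lemma volume_univ_torus : volume (Set.univ : Set Torus) = 1 := by
  simp [volume_pi, Measure.pi_univ]

lemma exists_sub_nsmul_mem_sub_nsmul_notMem {E : Type*} [NormedAddCommGroup E] [NormedSpace ℝ E]
    {A : Set E} (hA : Bornology.IsBounded A) {w : E} (hw : w ≠ 0) {p : E} (hp : p ∈ A) :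
    ∃ n : ℕ, p - n • w ∈ A ∧ p - (n + 1) • w ∉ A := by
  by_contra! hstep
  have hmem : ∀ n : ℕ, p - n • w ∈ A := fun n => by
    induction n with
    | zero => simpa using hp
    | succ n ih => exact hstep n ih
  obtain ⟨R, hR⟩ := hA.exists_norm_le
  obtain ⟨n, hn⟩ := exists_nat_gt ((‖p‖ + R) / ‖w‖)
  rw [div_lt_iff₀ (norm_pos_iff.2 hw), ← nsmul_eq_mul, ← RCLike.norm_nsmul ℝ] at hn
  have htri := norm_sub_le p (p - n • w)
  rw [sub_sub_cancel] at htri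
  linarith [hR _ (hmem n)]

section FundamentalDomain

variable {A : Set (Fin 2 → ℝ)} (hA : IsCompact A) (hvol : volume A ≤ 1)
  (hsurj : torusMk '' A = Set.univ)
include hA hvol hsurj

/-- Removing the overlap does not change the image on the torus: a point of `A` can be moved by
multiples of `-w` until its next translate leaves `A`. -/
lemma volume_inter_translate_eq_zero {w : Fin 2 → ℤ} (hw : w ≠ 0) :
    volume (A ∩ (fun p => p - intVec w) ⁻¹' A) = 0 := by
  have hw' : intVec w ≠ 0 := fun h => hw (funext fun i => Int.cast_eq_zero.1 (congrFun h i))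
  set A' := (fun p => p - intVec w) ⁻¹' A
  have hA' : MeasurableSet A' := hA.measurableSet.preimage (measurable_sub_const _)
  have hcover : torusMk '' (A \ A') = Set.univ := by
    refine Set.eq_univ_of_forall fun x => ?_
    obtain ⟨p, hp, rfl⟩ := hsurj.symm ▸ Set.mem_univ x
    obtain ⟨n, hn, hn'⟩ := exists_sub_nsmul_mem_sub_nsmul_notMem hA.isBounded hw' hp
    refine ⟨p - n • intVec w, ⟨hn, fun h => hn' ?_⟩, ?_⟩
    · rwa [succ_nsmul, ← sub_sub]
    · rw [map_sub, map_nsmul, torusMk_intVec, smul_zero, sub_zero]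
  have hdiff : 1 ≤ volume (A \ A') := by
    rw [← volume_univ_torus, ← hcover]
    exact volume_torusMk_image_le (hA.measurableSet.diff hA')
  have hsum : volume (A ∩ A') + 1 ≤ 0 + 1 :=
    calc volume (A ∩ A') + 1 ≤ volume (A ∩ A') + volume (A \ A') := by gcongr
      _ = volume A := measure_inter_add_sdiff A hA'
      _ ≤ 0 + 1 := by rwa [zero_add]
  exact nonpos_iff_eq_zero.1 (ENNReal.le_of_add_le_add_right ENNReal.one_ne_top hsum)

theorem ae_unique_lift :
    ∀ᵐ x : Torus, ∀ a ∈ A, ∀ a' ∈ A, torusMk a = x → torusMk a' = x → a = a' := by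
  have hoverlap : volume (⋃ w : {w : Fin 2 → ℤ // w ≠ 0},
      torusMk '' (A ∩ (fun p => p - intVec w.1) ⁻¹' A)) = 0 := by
    refine measure_iUnion_null fun w => nonpos_iff_eq_zero.1 ?_
    rw [← volume_inter_translate_eq_zero hA hvol hsurj w.2]
    exact volume_torusMk_image_le
      (hA.measurableSet.inter (hA.measurableSet.preimage (measurable_sub_const _)))
  rw [ae_iff]
  refine measure_mono_null (fun x hx => ?_) hoverlap
  rw [Set.mem_ofPred_eq] at hx
  push Not at hx
  obtain ⟨a, ha, a', ha', h, h', hne⟩ := hx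
  obtain ⟨w, hw⟩ := torusMk_eq_iff.1 (h.trans h'.symm)
  refine Set.mem_iUnion.2 ⟨⟨w, ?_⟩, a, ⟨ha, ?_⟩, h⟩
  · rintro rfl
    exact hne (sub_eq_zero.1 (hw.symm.trans (map_zero _)))
  · rwa [Set.mem_preimage, hw, sub_sub_cancel]

end FundamentalDomain

lemma continuous_toralMap (N : Matrix (Fin 2) (Fin 2) ℤ) : Continuous (toralMap N) :=
  continuous_pi fun i => continuous_finsetSum Finset.univ fun j _ =>
    (continuous_zsmul (N i j)).comp (continuous_apply (A := fun _ => UnitAddCircle) j)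

lemma measurePreserving_toralMap {N : Matrix (Fin 2) (Fin 2) ℤ} (h : IsUnit N.det) :
    MeasurePreserving (toralMap N) := by
  refine AddMonoidHom.measurePreserving (continuous_toralMap N) (fun x => ?_) rfl
  exact ⟨toralMap N⁻¹ x, by rw [← toralMap_mul, Matrix.mul_nonsing_inv N h, toralMap_one]⟩

lemma isCompact_rectangles (β κ s : ℝ) : IsCompact (rectangles β κ s) :=
  (isCompact_Icc.prod isCompact_Icc).union (isCompact_Icc.prod isCompact_Icc)

lemma volume_rectangles_le {β κ s : ℝ} (hκ : 0 ≤ κ) (hs : 1 - β ≤ s) :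
    volume (rectangles β κ s) ≤ ENNReal.ofReal (κ + s - 1 + β) := by
  refine (measure_union_le _ _).trans (le_of_eq ?_)
  simp only [Measure.volume_eq_prod, Measure.prod_prod, Real.volume_Icc]
  rw [← ENNReal.ofReal_mul (by norm_num), ← ENNReal.ofReal_mul (by linarith),
    ← ENNReal.ofReal_add (by linarith) (by linarith)]
  congr 1
  ring

lemma QuasiGreedy.eq_of_future_eq {β : ℝ} {q : ℕ → ℕ} (H : QuasiGreedy β q) {e e' : ℤ → ℕ}
    (he : Admissible q e) (he' : Admissible q e') (h : ∀ n, future β e n = future β e' n) :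
    e = e' := by
  funext n
  have hn := H.mul_future he (n - 1)
  rw [h, h, H.mul_future he', sub_add_cancel] at hn
  exact_mod_cast (add_right_cancel hn).symm

lemma eventually_atBot_eq_zero_of_finite {e : ℤ → ℕ} (h : {n | e n ≠ 0}.Finite) :
    ∀ᶠ n in atBot, e n = 0 := by
  have hcofinite := h.eventually_cofinite_notMem
  rw [Int.cofinite_eq] at hcofinite
  exact hcofinite.filter_mono le_sup_left |>.mono fun n hn => not_not.1 hn

lemma past_eq_zero (μ : ℝ) {e : ℤ → ℕ} {n : ℤ} (h : ∀ k ≤ n, e k = 0) : past μ e n = 0 := by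
  have hterm : ∀ k : ℕ, (e (n - k) : ℝ) * μ ^ k = 0 := fun k => by
    rw [h _ (by lia), Nat.cast_zero, zero_mul]
  simp only [past, hterm, tsum_zero, neg_zero]

lemma QuasiGreedy.value_tail_lt_one_of_finite {β : ℝ} {q : ℕ → ℕ} (H : QuasiGreedy β q)
    {e : ℤ → ℕ} (he : Admissible q e) (hfin : {n | e n ≠ 0}.Finite) (n : ℤ) (k : ℕ) :
    value β (tail (tail e n) k) < 1 := by
  rw [tail_tail]
  exact H.value_lt_one (he.tail _) (H.toLex_tail_lt_of_finite he hfin _)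

namespace IsUnitPair

variable {β μ : ℝ} {r σ : ℤ} (H : IsUnitPair β μ r σ)
include H

lemma mem_conjLattice_of_mul_mem {u v : ℝ} (h : (β * u, μ * v) ∈ conjLattice β μ) :
    (u, v) ∈ conjLattice β μ := by
  have hσ : (β * μ) * (β * μ) = 1 := by
    rw [H.mul_eq]
    exact_mod_cast Int.isUnit_mul_self H.isUnit_norm
  have hcomb := (conjLattice β μ).zsmul_mem ((conjLattice β μ).sub_mem
    ((conjLattice β μ).zsmul_mem h r) (H.mul_mem_conjLattice h)) σ
  simp only [Prod.smul_mk, Prod.mk_sub_mk, zsmul_eq_mul, ← H.add_eq, ← H.mul_eq] at hcomb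
  convert! hcomb using 2
  · linear_combination (-u) * hσ
  · linear_combination (-v) * hσ

lemma future_past_sub_mem_conjLattice_of_nonpos {e e' : ℤ → ℕ}
    (he : Admissible (quasiGreedyDigits r σ) e) (he' : Admissible (quasiGreedyDigits r σ) e')
    (h : (future β e 0, past μ e 0) - (future β e' 0, past μ e' 0) ∈ conjLattice β μ) {n : ℤ}
    (hn : n ≤ 0) :
    (future β e n, past μ e n) - (future β e' n, past μ e' n) ∈ conjLattice β μ := by
  induction n, hn using Int.leInductionDown with
  | base => exact h
  | pred n _ ih =>
    have hmul := (conjLattice β μ).add_mem ih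
      (intCast_mem_conjLattice β μ ((e n : ℤ) - e' n))
    refine H.mem_conjLattice_of_mul_mem ?_
    have hf := H.quasiGreedy.mul_future he (n - 1)
    have hf' := H.quasiGreedy.mul_future he' (n - 1)
    have hp := H.past_add_one he (n - 1)
    have hp' := H.past_add_one he' (n - 1)
    rw [sub_add_cancel] at hf hf' hp hp'
    simp only [Prod.mk_sub_mk, Prod.mk_add_mk] at hmul
    convert! hmul using 2
    · push_cast
      linear_combination hf - hf'
    · push_cast
      linear_combination hp' - hp

end IsUnitPair

section Bijective

variable {N : Matrix (Fin 2) (Fin 2) ℤ} {β μ : ℝ} (H : IsUnitPair β μ N.trace N.det)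
  {l : Fin 2 → ℤ}
include H

lemma det_planeMap_comp_finTwoArrow (l : Fin 2 → ℤ) :
    LinearMap.det (planeMap N β μ (intVec l) ∘ₗ (LinearEquiv.finTwoArrow ℝ ℝ).toLinearMap) =
      -(β - μ)⁻¹ * cyclicDet N l := by
  have hs := H.sub_pos.ne'
  rw [← LinearMap.det_toMatrix', Matrix.det_fin_two]
  simp only [LinearMap.toMatrix'_apply, LinearMap.comp_apply, LinearEquiv.coe_coe,
    LinearEquiv.finTwoArrow_apply, planeMap_apply, realAct_intVec, Pi.add_apply, Pi.sub_apply,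
    Pi.smul_apply, Pi.single_apply, intVec_apply, smul_eq_mul, cyclicDet,
    if_true, zero_ne_one, one_ne_zero, if_false, Int.cast_sub, Int.cast_mul]
  field_simp
  ring

lemma volume_planeMap_image (hl : IsUnit (cyclicDet N l)) {Ω : Set (ℝ × ℝ)}
    (hΩ : MeasurableSet Ω) :
    volume (planeMap N β μ (intVec l) '' Ω) = ENNReal.ofReal (β - μ)⁻¹ * volume Ω := by
  have himage : planeMap N β μ (intVec l) '' Ω =
      (planeMap N β μ (intVec l) ∘ₗ (LinearEquiv.finTwoArrow ℝ ℝ).toLinearMap) ''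
        (MeasurableEquiv.finTwoArrow ⁻¹' Ω) := by
    rw [LinearMap.coe_comp, Set.image_comp]
    exact congrArg _ (Set.image_preimage_eq _ (LinearEquiv.finTwoArrow ℝ ℝ).surjective).symm
  have habs : |(cyclicDet N l : ℝ)| = 1 := by
    exact_mod_cast Int.isUnit_iff_abs_eq.1 hl
  rw [himage, Measure.addHaar_image_linearMap, det_planeMap_comp_finTwoArrow H, abs_mul, abs_neg,
    habs, mul_one, abs_of_pos (inv_pos.2 H.sub_pos),
    (volume_preserving_finTwoArrow ℝ).measure_preimage hΩ.nullMeasurableSet]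

theorem exists_compact_lift (hl : IsUnit (cyclicDet N l)) :
    ∃ A : Set (Fin 2 → ℝ), IsCompact A ∧ volume A ≤ 1 ∧ ∀ ε : SymbolicSpace β,
      Admissible (quasiGreedyDigits N.trace N.det) ε.digit →
        planeMap N β μ (intVec l) (H.codingPair ε) ∈ A := by
  obtain ⟨κ, s, hκ, hs, hκs, hmem⟩ := H.exists_rectangles
  have hΩ := isCompact_rectangles β κ s
  refine ⟨planeMap N β μ (intVec l) '' rectangles β κ s,
    hΩ.image (LinearMap.continuous_of_finiteDimensional _), ?_, fun ε hε => ⟨_, hmem _ hε 0, rfl⟩⟩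
  have hpos := H.sub_pos
  calc volume (planeMap N β μ (intVec l) '' rectangles β κ s)
      = ENNReal.ofReal (β - μ)⁻¹ * volume (rectangles β κ s) :=
        volume_planeMap_image H hl hΩ.measurableSet
    _ ≤ ENNReal.ofReal (β - μ)⁻¹ * ENNReal.ofReal (κ + s - 1 + β) := by
        gcongr
        exact volume_rectangles_le hκ hs
    _ = 1 := by
        rw [← ENNReal.ofReal_mul (inv_nonneg.2 hpos.le),
          show κ + s - 1 + β = β - μ by linear_combination hκs, inv_mul_cancel₀ hpos.ne',
          ENNReal.ofReal_one]

theorem exists_admissible_codingHom_eq (hl : cyclicDet N l ≠ 0) (x : Torus) :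
    ∃ ε : SymbolicSpace β, Admissible (quasiGreedyDigits N.trace N.det) ε.digit ∧
      codingHom H l ε = x := by
  obtain ⟨y, rfl⟩ := torusMk_surjective x
  obtain ⟨p, rfl⟩ := planeMap_surjective H hl y
  obtain ⟨ε, hε, hp⟩ := H.exists_admissible_sub_codingPair_mem p
  exact ⟨ε, hε, codingHom_eq_of_sub_mem H l hp⟩

lemma codingHom_comp_add {e : ℤ → ℕ} {R : ℕ} (h : ∀ n, e n ≤ R) (n : ℤ) :
    codingHom H l (ofBounded H.one_lt (fun k => e (k + n)) fun _ => h _) =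
      toralMap (N ^ n) (codingHom H l (ofBounded H.one_lt e h)) := by
  have hstep : ∀ n : ℤ, codingHom H l (ofBounded H.one_lt (fun k => e (k + (n + 1))) fun _ => h _) =
      toralMap N (codingHom H l (ofBounded H.one_lt (fun k => e (k + n)) fun _ => h _)) := by
    intro n
    rw [← codingHom_shift]
    congr 1
    refine SymbolicSpace.ext fun k => congrArg e ?_
    ring
  induction n using Int.induction_on with
  | zero => simp only [add_zero, zpow_zero, toralMap_one]
  | succ n ih =>
    rw [hstep, ih, ← toralMap_mul, add_comm _ (1 : ℤ), Matrix.zpow_one_add H.isUnit_norm]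
  | pred n ih =>
    apply toralMap_injective N H.isUnit_norm
    rw [← hstep, ← toralMap_mul, ← Matrix.zpow_one_add H.isUnit_norm]
    simpa only [add_sub_cancel, sub_add_cancel] using ih

/-- For almost every `x`, every image of `x` under a power of `T` has a unique lift to the compact
set. The lift of `Tⁿ x` determines the future at time `n` of any admissible expansion of `x`. -/
theorem ae_existsUnique (hl : IsUnit (cyclicDet N l)) :
    ∀ᵐ x : Torus, ∃! ε : SymbolicSpace β,
      Admissible (quasiGreedyDigits N.trace N.det) ε.digit ∧ codingHom H l ε = x := by
  obtain ⟨A, hA, hvol, hmem⟩ := exists_compact_lift H hl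
  have hsurj : torusMk '' A = Set.univ := Set.eq_univ_of_forall fun x => by
    obtain ⟨ε, hε, hx⟩ := exists_admissible_codingHom_eq H hl.ne_zero x
    exact ⟨_, hmem ε hε, hx⟩
  have hlift := ae_all_iff.2 fun n : ℤ =>
    (measurePreserving_toralMap (H.isUnit_norm.det_zpow n)).quasiMeasurePreserving.ae
      (ae_unique_lift hA hvol hsurj)
  filter_upwards [hlift] with x hx
  refine existsUnique_of_exists_of_unique (exists_admissible_codingHom_eq H hl.ne_zero x) ?_
  rintro ε ε' ⟨hε, rfl⟩ ⟨hε', hεε'⟩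
  refine SymbolicSpace.ext <| congrFun <| H.quasiGreedy.eq_of_future_eq hε hε' fun n => ?_
  have hpair := planeMap_injective H hl.ne_zero <| hx n _ (hmem _ (hε.comp_add n)) _
    (hmem _ (hε'.comp_add n)) (codingHom_comp_add H hε.le_zero n)
    ((codingHom_comp_add H hε'.le_zero n).trans (congrArg _ hεε'))
  have hfst := congrArg Prod.fst hpair
  rwa [H.codingPair_apply, H.codingPair_apply, digit_ofBounded, digit_ofBounded, future_comp_add,
    future_comp_add, zero_add] at hfst

theorem injOn_codingHom_finite (hl : IsUnit (cyclicDet N l)) :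
    Set.InjOn (codingHom H l)
      {ε | Admissible (quasiGreedyDigits N.trace N.det) ε.digit ∧ ε.IsFinite} := by
  rintro ε ⟨hε, hfin⟩ ε' ⟨hε', hfin'⟩ h
  have Q := H.quasiGreedy
  rw [codingHom_apply, codingHom_apply, ← sub_eq_zero, ← map_sub, ← map_sub] at h
  have hmem := mem_conjLattice_of_torusMk_eq_zero H hl h
  obtain ⟨m, hm⟩ := ((eventually_atBot_eq_zero_of_finite hfin).and <|
    (eventually_atBot_eq_zero_of_finite hfin').and <| eventually_le_atBot 0).exists_forall_of_atBot
  have hback := H.future_past_sub_mem_conjLattice_of_nonpos hε hε' hmem (hm m le_rfl).2.2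
  rw [past_eq_zero μ fun k hk => (hm k hk).1, past_eq_zero μ fun k hk => (hm k hk).2.1,
    Prod.mk_sub_mk, sub_zero] at hback
  have htail : tail ε.digit (m + 1) = tail ε'.digit (m + 1) :=
    eq_of_value_eq H.pos (Q.summable_of_admissible (hε.tail _))
      (Q.summable_of_admissible (hε'.tail _))
      (fun k => Q.value_tail_lt_one_of_finite hε hfin _ k)
      (fun k => Q.value_tail_lt_one_of_finite hε' hfin' _ k)
      (sub_eq_zero.1 (H.eq_zero_of_mem_conjLattice hback))
  refine SymbolicSpace.ext fun n => ?_
  rcases le_or_gt n m with hn | hn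
  · rw [(hm n hn).1, (hm n hn).2.1]
  · obtain ⟨k, rfl⟩ := Int.exists_add_of_le (Int.add_one_le_iff.2 hn)
    exact congrFun htail k

end Bijective

theorem admitsBijectiveArithmeticCoding_of_isUnit {N : Matrix (Fin 2) (Fin 2) ℤ} {μ : ℝ}
    (H : IsUnitPair (leadingEigenvalue N) μ N.trace N.det) {l : Fin 2 → ℤ}
    (hl : IsUnit (cyclicDet N l)) : AdmitsBijectiveArithmeticCoding N := by
  refine ⟨codingHom H l, {ε | Admissible (quasiGreedyDigits N.trace N.det) ε.digit},
    { continuous := continuous_codingHom H l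
      map_shift := codingHom_shift H l
      isClosed := ?_
      shift_invariant := fun ε => ⟨fun h => ?_, fun h => h.comp_add 1⟩
      total := fun ε hε ε' ⟨n, hn⟩ k => (le_of_lt (a := toLex _) (hn k)).trans (hε n)
      surjective := exists_admissible_codingHom_eq H hl.ne_zero
      injective_on_finite := injOn_codingHom_finite H hl }, ae_existsUnique H hl⟩
  · exact (isCompact_setOf_admissible _).isClosed.preimage
      (continuous_pi SymbolicSpace.continuous_digit)
  · simpa only [Set.mem_ofPred_eq, digit_shift, neg_add_cancel_right] using h.comp_add (-1)

namespace IsHyperbolic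

variable {N : Matrix (Fin 2) (Fin 2) ℤ} (hN : IsHyperbolic N)
include hN

lemma neg : IsHyperbolic (-N) := by
  intro z hz
  have hmap : (-N).map (Int.cast : ℤ → ℂ) = -N.map Int.cast := Matrix.map_neg _ Int.cast_neg N
  rw [hmap, ← spectrum.neg_eq] at hz
  simpa only [norm_neg] using hN (-z) hz

lemma norm_ne_one {z : ℂ} (hz : z ^ 2 - N.trace * z + N.det = 0) : ‖z‖ ≠ 1 := by
  refine hN z ?_
  rw [spectrum.mem_iff, Matrix.isUnit_iff_isUnit_det, isUnit_iff_ne_zero, not_not,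
    Matrix.det_fin_two, ← hz, Matrix.trace_fin_two, Matrix.det_fin_two]
  simp [Matrix.algebraMap_matrix_apply]
  ring

lemma three_le_trace (hdet : N.det = 1) (htr : 0 < N.trace) : 3 ≤ N.trace := by
  by_contra! hlt
  obtain htr | htr : N.trace = 1 ∨ N.trace = 2 := by lia
  · refine hN.norm_ne_one (z := (1 / 2 : ℝ) + (√3 / 2 : ℝ) * Complex.I) ?_ ?_
    · have hsq : ((√3 : ℝ) : ℂ) ^ 2 = 3 := by
        rw [← Complex.ofReal_pow, Real.sq_sqrt (by norm_num), Complex.ofReal_ofNat]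
      rw [htr, hdet]
      push_cast
      linear_combination (1 / 4 : ℂ) * Complex.I ^ 2 * hsq + (3 / 4 : ℂ) * Complex.I_sq
    · rw [Complex.norm_add_mul_I, Real.sqrt_eq_one, div_pow, div_pow, Real.sq_sqrt (by norm_num)]
      norm_num
  · exact hN.norm_ne_one (z := 1) (by rw [htr, hdet]; norm_num) norm_one

lemma exists_isUnitPair (hdet : IsUnit N.det) (htr : 0 < N.trace) :
    ∃ μ, IsUnitPair (leadingEigenvalue N) μ N.trace N.det := by
  have hbound : 0 ≤ N.det + 1 ∧ N.det + 1 < N.trace := by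
    rcases Int.isUnit_iff.1 hdet with h | h
    · have := hN.three_le_trace h htr
      lia
    · lia
  have hlow : (0 : ℝ) ≤ N.det + 1 := by exact_mod_cast hbound.1
  have hhigh : (N.det : ℝ) + 1 < N.trace := by exact_mod_cast hbound.2
  have hdisc : (1 - N.det : ℝ) ^ 2 < N.trace ^ 2 - 4 * N.det := by nlinarith
  have hsq := Real.sq_sqrt ((sq_nonneg _).trans hdisc.le)
  have hlt := Real.lt_sqrt_of_sq_lt hdisc
  refine ⟨(N.trace - √(N.trace ^ 2 - 4 * N.det)) / 2, ?_, ?_, ?_, hdet⟩ <;>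
    rw [leadingEigenvalue]
  · linarith
  · ring
  · linear_combination (-1 / 4 : ℝ) * hsq

end IsHyperbolic

lemma exists_isUnit_cyclicDet_iff (N : Matrix (Fin 2) (Fin 2) ℤ) :
    (∃ l, IsUnit (cyclicDet N l)) ↔
      ∃ x y : ℤ, associatedForm N x y = 1 ∨ associatedForm N x y = -1 := by
  simp only [← Int.isUnit_iff]
  constructor
  · rintro ⟨l, hl⟩
    exact ⟨l 1, -l 0, by rwa [associatedForm_eq_neg_cyclicDet, IsUnit.neg_iff]⟩
  · rintro ⟨x, y, h⟩
    refine ⟨![-y, x], ?_⟩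
    rw [← IsUnit.neg_iff, ← associatedForm_eq_neg_cyclicDet]
    simpa using h

theorem admitsBijectiveArithmeticCoding_iff {N : Matrix (Fin 2) (Fin 2) ℤ} (hN : IsHyperbolic N)
    (hdet : IsUnit N.det) (htr : 0 < N.trace) :
    AdmitsBijectiveArithmeticCoding N ↔
      ∃ x y : ℤ, associatedForm N x y = 1 ∨ associatedForm N x y = -1 := by
  obtain ⟨μ, H⟩ := hN.exists_isUnitPair hdet htr
  rw [← exists_isUnit_cyclicDet_iff]
  constructor
  · rintro ⟨φ, X, hX, hae⟩
    have : NeZero (volume : Measure Torus) :=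
      ⟨fun h => zero_ne_one (by rw [← volume_univ_torus, h, Measure.coe_zero, Pi.zero_apply])⟩
    exact exists_isUnit_cyclicDet H hX hae.exists
  · rintro ⟨l, hl⟩
    exact admitsBijectiveArithmeticCoding_of_isUnit H hl

end ToralCoding

end

theorem theorem2p5 (M : GL (Fin 2) ℤ)
    (hM : IsHyperbolic (M : Matrix (Fin 2) (Fin 2) ℤ))
    (r σ : ℤ) (hr : r = (M : Matrix (Fin 2) (Fin 2) ℤ).trace)
    (hσ : σ = (M : Matrix (Fin 2) (Fin 2) ℤ).det) :
    -- bijective arithmetic codings exist iff `M` is conjugate to its companion matrix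
    (0 < r →
      (AdmitsBijectiveArithmeticCoding (M : Matrix (Fin 2) (Fin 2) ℤ) ↔
        AlgebraicallyConjugate (M : Matrix (Fin 2) (Fin 2) ℤ) (companionMatrix r σ))) ∧
    -- for negative trace the coding is that of the automorphism with matrix `-M`
    (r < 0 →
      (AdmitsBijectiveArithmeticCoding (-(M : Matrix (Fin 2) (Fin 2) ℤ)) ↔
        AlgebraicallyConjugate (M : Matrix (Fin 2) (Fin 2) ℤ) (companionMatrix r σ))) ∧
    -- the conjugacy holds iff `f(x, y) = ±1` is solvable
    (AlgebraicallyConjugate (M : Matrix (Fin 2) (Fin 2) ℤ) (companionMatrix r σ) ↔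
      ∃ x y : ℤ, associatedForm (M : Matrix (Fin 2) (Fin 2) ℤ) x y = 1 ∨
        associatedForm (M : Matrix (Fin 2) (Fin 2) ℤ) x y = -1) ∧
    -- taking the first row is a bijection from the conjugating matrices onto the solutions
    Set.BijOn
      (fun B : GL (Fin 2) ℤ =>
        ((B : Matrix (Fin 2) (Fin 2) ℤ) 0 0, (B : Matrix (Fin 2) (Fin 2) ℤ) 0 1))
      {B | Conjugates B (M : Matrix (Fin 2) (Fin 2) ℤ) (companionMatrix r σ)}
      {p | associatedForm (M : Matrix (Fin 2) (Fin 2) ℤ) p.1 p.2 = 1 ∨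
        associatedForm (M : Matrix (Fin 2) (Fin 2) ℤ) p.1 p.2 = -1} ∧
    -- and the second row is `(z, t) = -det M · (x, y) M⁻¹`
    (∀ B : GL (Fin 2) ℤ,
      Conjugates B (M : Matrix (Fin 2) (Fin 2) ℤ) (companionMatrix r σ) →
      (B : Matrix (Fin 2) (Fin 2) ℤ) 1 =
        (-σ) • Matrix.vecMul ((B : Matrix (Fin 2) (Fin 2) ℤ) 0)
          ((M⁻¹ : GL (Fin 2) ℤ) : Matrix (Fin 2) (Fin 2) ℤ)) := by
  subst hr hσ
  have hdet := (Matrix.isUnit_iff_isUnit_det _).1 M.isUnit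
  have hdetneg : (-(M : Matrix (Fin 2) (Fin 2) ℤ)).det = (M : Matrix (Fin 2) (Fin 2) ℤ).det := by
    rw [Matrix.det_neg, Fintype.card_fin, neg_one_sq, one_mul]
  have hconj := algebraicallyConjugate_companionMatrix_iff (M : Matrix (Fin 2) (Fin 2) ℤ)
  refine ⟨fun hr => ?_, fun hr => ?_, hconj, bijOn_conjugates _, fun B => second_row_of_conjugates⟩
  · rw [hconj]
    exact admitsBijectiveArithmeticCoding_iff hM hdet hr
  · rw [hconj, admitsBijectiveArithmeticCoding_iff hM.neg (hdetneg ▸ hdet)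
      (by rwa [Matrix.trace_neg, neg_pos])]
    simp only [associatedForm_neg, neg_eq_iff_eq_neg, neg_neg, or_comm]
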